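/- Let $a>0$, $l>0$, $b\in\mathbb R$, and let $\gamma:[0,\infty)\to\mathbb R$ satisfy $\gamma(0)=0$, $\gamma(t)<l$ and $\gamma'(t)\in(-a,a)$ for all $t\ge 0$, $\gamma(t)+at\to+\infty$ and $\gamma(t)-at\to-\infty$ as $t\to+\infty$. Put $Q=\{(t,x): t>0,\ \gamma(t)<x<l\}$. Assume $\varphi\in C^2([0,l])$, $\psi\in C^1([0,l])$, $\mu_1\in C^2([0,\infty))$, $\mu_2\in C([0,\infty))$, $\gamma\in C^2([0,\infty))$, $f\in C^1(\overline Q)$. Consider the mixed problem $$(\partial_t^2-a^2\partial_x^2)u=f\ \text{ in } Q,\qquad u(0,x)=\varphi(x),\quad \partial_tu(0,x)=\psi(x),\quad x\in[0,l],$$ $$u(t,\gamma(t))=\mu_1(t),\qquad (\partial_t^2+b\,\partial_x)u(t,l)=\mu_2(t),\qquad t\in[0,\infty).$$ It has a unique solution in the class $C^2(\overline Q)$ if and only if the following matching conditions hold: $$\mu_1(0)-\varphi(0)=0,\qquad \mu_1'(0)-\psi(0)-\gamma'(0)\varphi'(0)=0,$$ $$\mu_1''(0)-\bigl(a^2+\gamma'(0)^2\bigr)\varphi''(0)-f(0,0)-2\gamma'(0)\psi'(0)-\gamma''(0)\varphi'(0)=0,$$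 $$\mu_2(0)-f(0,l)-b\varphi'(l)-a^2\varphi''(l)=0.$$ The solution is given as follows. Let $\gamma_\pm(t)=\gamma(t)\pm at$ on $[0,\infty)$, let $\Phi_\pm$ be the inverse functions of $\gamma_\pm$, and let $l_0=r_0=0$, $l_i=r_{i-1}+a^{-1}(l-\gamma(r_{i-1}))$, $r_i=\Phi_+(l+al_{i-1})$ for $i\ge1$. Put $G_0=P_0=[0,l]$ and, for $i\ge 1$, $G_i=[\gamma_-(r_i),\gamma_-(r_{i-1})]$, $P_i=[l+al_{i-1},l+al_i]$; for $i,j\ge 0$ let $Q^{(i,j)}=\{(t,x)\in Q: x-at\in G_i,\ x+at\in P_j\}$. Then $\overline Q=\bigcup_{i,j}\overline{Q^{(i,j)}}$. There is a function $w\in C^2(\overline Q)$ with $(\partial_t^2-a^2\partial_x^2)w=f$ in $Q$ and $w(0,x)=\partial_tw(0,x)=0$ for $x\in[0,l]$. For every such $w$ and every real constant $C_1$, a solution $u\in C^2(\overline Q)$ satisfies $$u(t,x)=w(t,x)+g^{(i)}(x-at)+p^{(j)}(x+at),\qquad (t,x)\in\overline{Q^{(i,j)}},\quad i,j\ge 0,$$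 where $$g^{(0)}(z)=\frac{\varphi(z)}2-\frac1{2a}\int_0^z\psi(\xi)\,d\xi+C_1,\qquad p^{(0)}(z)=\frac{\varphi(z)}2+\frac1{2a}\int_0^z\psi(\xi)\,d\xi-C_1,\qquad z\in[0,l],$$ and for $j\ge1$, writing $L_j=l+al_{j-1}$, $$g^{(j)}(z)=\mu_1(\Phi_-(z))-p^{(j-1)}\bigl(\gamma(\Phi_-(z))+a\Phi_-(z)\bigr)-w\bigl(\Phi_-(z),\gamma(\Phi_-(z))\bigr),\qquad z\in G_j,$$ $$p^{(j)}(z)=p^{(j-1)}(L_j)+\int_{L_j}^z e^{b(L_j-\eta)/a^2}\Bigl(Dp^{(j-1)}(L_j-0)+\int_{L_j}^\eta a^{-2}e^{b(\xi-L_j)/a^2}F_j(\xi)\,d\xi\Bigr)d\eta,\qquad z\in P_j,$$ $$F_j(\xi)=\mu_2\Bigl(\frac{\xi-l}a\Bigr)-a^2D^2g^{(j-1)}(2l-\xi)-b\,Dg^{(j-1)}(2l-\xi)-b\,\partial_xw\Bigl(\frac{\xi-l}a,l\Bigr)-\partial_t^2w\Bigl(\frac{\xi-l}a,l\Bigr).$$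 -/

import Mathlib

open Set Filter Topology

namespace CurvilinearWave

noncomputable section

/-- The curvilinear half-strip `Q`, as a set of pairs `(t, x)`. -/
def halfStrip (l : ℝ) (γ : ℝ → ℝ) : Set (ℝ × ℝ) :=
  {q | 0 < q.1 ∧ γ q.1 < q.2 ∧ q.2 < l}

/-- The time derivative of `u` relative to the set `S` (one-sided on the boundary of `S`). -/
def dt (S : Set (ℝ × ℝ)) (u : ℝ × ℝ → ℝ) (q : ℝ × ℝ) : ℝ :=
  fderivWithin ℝ u S q (1, 0)

/-- The space derivative of `u` relative to the set `S` (one-sided on the boundary of `S`). -/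
def dx (S : Set (ℝ × ℝ)) (u : ℝ × ℝ → ℝ) (q : ℝ × ℝ) : ℝ :=
  fderivWithin ℝ u S q (0, 1)

/-- `u` is of class `C²` on the closure of `Q` and solves `u_tt - a² u_xx = f` in `Q`, with
`u = φ` and `u_t = ψ` at `t = 0`. -/
structure SolvesCauchy (a l : ℝ) (γ φ ψ : ℝ → ℝ) (f u : ℝ × ℝ → ℝ) : Prop where
  contDiffOn : ContDiffOn ℝ 2 u (closure (halfStrip l γ))
  wave : ∀ q ∈ halfStrip l γ,
    dt (closure (halfStrip l γ)) (dt (closure (halfStrip l γ)) u) q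
      - a ^ 2 * dx (closure (halfStrip l γ)) (dx (closure (halfStrip l γ)) u) q = f q
  initial : ∀ x ∈ Icc 0 l, u (0, x) = φ x
  initial_dt : ∀ x ∈ Icc 0 l, dt (closure (halfStrip l γ)) u (0, x) = ψ x

/-- `u` is a solution, of class `C²` on the closure of `Q`, of the mixed problem with `v = 0`. -/
structure SolvesMixed (a b l : ℝ) (γ φ ψ μ₁ μ₂ : ℝ → ℝ) (f u : ℝ × ℝ → ℝ) : Prop
    extends SolvesCauchy a l γ φ ψ f u where
  boundary_left : ∀ t ∈ Ici (0 : ℝ), u (t, γ t) = μ₁ t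
  boundary_right : ∀ t ∈ Ici (0 : ℝ),
    dt (closure (halfStrip l γ)) (dt (closure (halfStrip l γ)) u) (t, l)
      + b * dx (closure (halfStrip l γ)) u (t, l) = μ₂ t

/-- The matching conditions at the corners `(0, 0)` and `(0, l)`. -/
structure Matching (a b l : ℝ) (γ φ ψ μ₁ μ₂ : ℝ → ℝ) (f : ℝ × ℝ → ℝ) : Prop where
  left_zero : μ₁ 0 - φ 0 = 0
  left_one : derivWithin μ₁ (Ici 0) 0 - ψ 0
    - derivWithin γ (Ici 0) 0 * derivWithin φ (Icc 0 l) 0 = 0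
  left_two : iteratedDerivWithin 2 μ₁ (Ici 0) 0
    - (a ^ 2 + derivWithin γ (Ici 0) 0 ^ 2) * iteratedDerivWithin 2 φ (Icc 0 l) 0
    - f (0, 0)
    - 2 * derivWithin γ (Ici 0) 0 * derivWithin ψ (Icc 0 l) 0
    - iteratedDerivWithin 2 γ (Ici 0) 0 * derivWithin φ (Icc 0 l) 0 = 0
  right_two : μ₂ 0 - f (0, l) - b * derivWithin φ (Icc 0 l) l
    - a ^ 2 * iteratedDerivWithin 2 φ (Icc 0 l) l = 0

/-- `γ₊(t) = γ(t) + a t`. -/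
def gammaPlus (a : ℝ) (γ : ℝ → ℝ) (t : ℝ) : ℝ := γ t + a * t

/-- `γ₋(t) = γ(t) - a t`. -/
def gammaMinus (a : ℝ) (γ : ℝ → ℝ) (t : ℝ) : ℝ := γ t - a * t

/-- `Φ₊`, the inverse of `γ₊` on `[0, ∞)`. -/
def phiPlus (a : ℝ) (γ : ℝ → ℝ) : ℝ → ℝ := Function.invFunOn (gammaPlus a γ) (Ici 0)

/-- `Φ₋`, the inverse of `γ₋` on `[0, ∞)`. -/
def phiMinus (a : ℝ) (γ : ℝ → ℝ) : ℝ → ℝ := Function.invFunOn (gammaMinus a γ) (Ici 0)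

/-- The pairs `(lᵢ, rᵢ)` with `l₀ = r₀ = 0`, `lᵢ = rᵢ₋₁ + (l - γ(rᵢ₋₁)) / a` and
`rᵢ = Φ₊(l + a lᵢ₋₁)`. -/
def nodes (a l : ℝ) (γ : ℝ → ℝ) : ℕ → ℝ × ℝ
  | 0 => (0, 0)
  | n + 1 =>
    ((nodes a l γ n).2 + (l - γ (nodes a l γ n).2) / a,
      phiPlus a γ (l + a * (nodes a l γ n).1))

/-- The times `lᵢ`, at which the characteristics meet the line `x = l`. -/
def lNode (a l : ℝ) (γ : ℝ → ℝ) (n : ℕ) : ℝ := (nodes a l γ n).1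

/-- The times `rᵢ`, at which the characteristics meet the curve `x = γ(t)`. -/
def rNode (a l : ℝ) (γ : ℝ → ℝ) (n : ℕ) : ℝ := (nodes a l γ n).2

/-- The interval of definition of `g⁽ⁱ⁾`. -/
def gDom (a l : ℝ) (γ : ℝ → ℝ) : ℕ → Set ℝ
  | 0 => Icc 0 l
  | n + 1 => Icc (gammaMinus a γ (rNode a l γ (n + 1))) (gammaMinus a γ (rNode a l γ n))

/-- The interval of definition of `p⁽ʲ⁾`. -/
def pDom (a l : ℝ) (γ : ℝ → ℝ) : ℕ → Set ℝ
  | 0 => Icc 0 l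
  | n + 1 => Icc (l + a * lNode a l γ n) (l + a * lNode a l γ (n + 1))

/-- The cell `Q⁽ⁱ ʲ⁾` of the partition of `Q` (empty unless `|i - j| ≤ 1`). -/
def cell (a l : ℝ) (γ : ℝ → ℝ) (i j : ℕ) : Set (ℝ × ℝ) :=
  halfStrip l γ ∩ {q | q.2 - a * q.1 ∈ gDom a l γ i ∧ q.2 + a * q.1 ∈ pDom a l γ j}

/-- The pairs `(g⁽ⁿ⁾, p⁽ⁿ⁾)`, given by d'Alembert's formula for `n = 0` and then recursively; `w` is
the chosen particular solution and `C` the free constant. The values are meaningful on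
`gDom a l γ n` and `pDom a l γ n`, and derivatives are taken relative to these intervals. -/
def gp (a b l : ℝ) (γ φ ψ μ₁ μ₂ : ℝ → ℝ) (w : ℝ × ℝ → ℝ) (C : ℝ) : ℕ → (ℝ → ℝ) × (ℝ → ℝ)
  | 0 =>
    (fun z => φ z / 2 - 1 / (2 * a) * (∫ ξ in (0 : ℝ)..z, ψ ξ) + C,
      fun z => φ z / 2 + 1 / (2 * a) * (∫ ξ in (0 : ℝ)..z, ψ ξ) - C)
  | n + 1 =>
    let S : Set (ℝ × ℝ) := closure (halfStrip l γ)
    let g : ℝ → ℝ := (gp a b l γ φ ψ μ₁ μ₂ w C n).1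
    let p : ℝ → ℝ := (gp a b l γ φ ψ μ₁ μ₂ w C n).2
    let L : ℝ := l + a * lNode a l γ n
    (fun z =>
      μ₁ (phiMinus a γ z) - p (γ (phiMinus a γ z) + a * phiMinus a γ z)
        - w (phiMinus a γ z, γ (phiMinus a γ z)),
      fun z =>
        p L + ∫ η in L..z, Real.exp (b * (L - η) / a ^ 2) *
          (derivWithin p (pDom a l γ n) L +
            ∫ ξ in L..η, (a ^ 2)⁻¹ * Real.exp (b * (ξ - L) / a ^ 2) *
              (μ₂ ((ξ - l) / a)
                - a ^ 2 * iteratedDerivWithin 2 g (gDom a l γ n) (2 * l - ξ)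
                - b * derivWithin g (gDom a l γ n) (2 * l - ξ)
                - b * dx S w ((ξ - l) / a, l)
                - dt S (dt S w) ((ξ - l) / a, l))))

/-- The function `g⁽ⁱ⁾`. -/
def gFun (a b l : ℝ) (γ φ ψ μ₁ μ₂ : ℝ → ℝ) (w : ℝ × ℝ → ℝ) (C : ℝ) (i : ℕ) : ℝ → ℝ :=
  (gp a b l γ φ ψ μ₁ μ₂ w C i).1

/-- The function `p⁽ʲ⁾`. -/
def pFun (a b l : ℝ) (γ φ ψ μ₁ μ₂ : ℝ → ℝ) (w : ℝ × ℝ → ℝ) (C : ℝ) (j : ℕ) : ℝ → ℝ :=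
  (gp a b l γ φ ψ μ₁ μ₂ w C j).2

end

end CurvilinearWave

open CurvilinearWave

/-! Off the boundary the problem is d'Alembert's: once a particular solution $W$ with zero Cauchy
data is subtracted, every $C^2$ solution is $g(x-at)+p(x+at)$. To avoid one-sided derivatives at
endpoints, the curve is first replaced by a $C^2$ curve on all of $\mathbb R$ that is still slower
than $a$ (`exists_slowCurve`), and the other data are extended as far as needed. Duhamel's formula
then gives a $W$ on the whole plane (`exists_particular`).

The splitting into two waves holds up to the boundary because $v_t\pm a v_x$ is constant along
characteristics, and every characteristic, followed forward, ends on exactly one lateral boundary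
(`SlowCurve.exists_waves_of_homogeneous`). The mixed problem thus becomes `WaveSystem`: conditions
on two profiles $g,p\in C^2(\mathbb R)$.

Necessity of the matching conditions. They say that the error of the initial profiles in the left
boundary condition vanishes at $t=0$ together with its first two derivatives, and that the error in
the right condition vanishes at $t=0$ (`matching_iff`). For a solution both errors vanish
identically on $[0,\infty)$.

Sufficiency. The left error, cut off to zero for $t<0$, is still $C^2$ and can be added to $g$; the
right error, cut off likewise, is still continuous and can serve as the source of an ODE whose
solution is added to $p$. Each correction disturbs the other boundary condition, but only later,
since waves travel at speed $a$. Iterating, the profiles become stationary on sets bounded by the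
reflection nodes, and these exhaust the line because the nodes tend to infinity; the limit solves
the problem (`exists_reflected_profiles`).

Formula and uniqueness. Given any solution, the two boundary conditions determine its profiles
interval by interval, and this is exactly the recursion for $g^{(i)},p^{(j)}$
(`WaveSystem.eqOn_gFun_pFun`). The recursion involves only the data, $w$ and the constant, so
uniqueness follows from the formula and the covering by closed cells. -/

namespace CurvilinearWave

/-! ### Extension, truncation and gluing of functions of one variable. -/

section Calculus

theorem contDiff_one_of_hasDerivAt {F F₁ : ℝ → ℝ} (h : ∀ x, HasDerivAt F (F₁ x) x)
    (hc : Continuous F₁) : ContDiff ℝ 1 F := by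
  have : deriv F = F₁ := funext fun x => (h x).deriv
  exact contDiff_one_iff_deriv.2 ⟨fun x => (h x).differentiableAt, this ▸ hc⟩

theorem contDiff_two_of_hasDerivAt {F F₁ : ℝ → ℝ} (h : ∀ x, HasDerivAt F (F₁ x) x)
    (hc : ContDiff ℝ 1 F₁) : ContDiff ℝ 2 F := by
  have : deriv F = F₁ := funext fun x => (h x).deriv
  refine (contDiff_succ_iff_deriv (n := 1)).2 ⟨fun x => (h x).differentiableAt, by simp, ?_⟩
  rw [this]; exact hc

theorem contDiff_one_deriv {F : ℝ → ℝ} (h : ContDiff ℝ 2 F) : ContDiff ℝ 1 (deriv F) :=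
  ((contDiff_succ_iff_deriv (n := 1)).1 h).2.2

theorem hasDerivAt_of_contDiff_one {F : ℝ → ℝ} (h : ContDiff ℝ 1 F) (x : ℝ) :
    HasDerivAt F (deriv F x) x :=
  ((h.differentiable (by norm_num)) x).hasDerivAt

theorem hasDerivAt_of_contDiff_two {F : ℝ → ℝ} (h : ContDiff ℝ 2 F) (x : ℝ) :
    HasDerivAt F (deriv F x) x :=
  ((h.differentiable (by norm_num)) x).hasDerivAt

theorem hasDerivAt_deriv_of_contDiff_two {F : ℝ → ℝ} (h : ContDiff ℝ 2 F) (x : ℝ) :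
    HasDerivAt (deriv F) (deriv (deriv F) x) x :=
  hasDerivAt_of_contDiff_one (contDiff_one_deriv h) x

theorem continuous_deriv_of_contDiff_one {F : ℝ → ℝ} (h : ContDiff ℝ 1 F) :
    Continuous (deriv F) := (contDiff_one_iff_deriv.1 h).2

theorem continuous_deriv_deriv {F : ℝ → ℝ} (h : ContDiff ℝ 2 F) :
    Continuous (deriv (deriv F)) := continuous_deriv_of_contDiff_one (contDiff_one_deriv h)

theorem hasDerivAt_integral_of_continuous {f : ℝ → ℝ} (hf : Continuous f) (c x : ℝ) :
    HasDerivAt (fun y => ∫ ξ in c..y, f ξ) (f x) x :=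
  intervalIntegral.integral_hasDerivAt_right (hf.intervalIntegrable _ _)
    hf.stronglyMeasurable.stronglyMeasurableAtFilter hf.continuousAt

theorem exists_continuous_extension {s : Set ℝ} (hs : IsClosed s) {f : ℝ → ℝ}
    (hf : ContinuousOn f s) : ∃ F : ℝ → ℝ, Continuous F ∧ EqOn F f s := by
  obtain ⟨G, hG⟩ := ContinuousMap.exists_restrict_eq hs ⟨s.domRestrict f, hf.domRestrict⟩
  refine ⟨G, G.continuous, fun x hx => ?_⟩
  have := congrArg (fun k : C(s, ℝ) => k ⟨x, hx⟩) hG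
  exact this

theorem eqOn_integral_of_eqOn_derivWithin {s : Set ℝ} (hs : Convex ℝ s) (hu : UniqueDiffOn ℝ s)
    {f F₁ : ℝ → ℝ} (hf : DifferentiableOn ℝ f s) (hF : Continuous F₁)
    (h : EqOn F₁ (derivWithin f s) s) {c : ℝ} (hc : c ∈ s) :
    EqOn (fun x => f c + ∫ ξ in c..x, F₁ ξ) f s := by
  have hd : ∀ x, HasDerivAt (fun x => f c + ∫ ξ in c..x, F₁ ξ) (F₁ x) x := fun x =>
    (hasDerivAt_integral_of_continuous hF c x).const_add _
  refine hs.eqOn_of_fderivWithin_eq (fun x _ => (hd x).differentiableAt.differentiableWithinAt)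
    hf hu (fun x hx => ?_) hc (by simp)
  rw [(hd x).hasDerivWithinAt.hasFDerivWithinAt.fderivWithin (hu x hx),
    (hf x hx).hasDerivWithinAt.hasFDerivWithinAt.fderivWithin (hu x hx), h hx]

/-- On an interval it suffices to extend the derivative continuously, by Tietze, and to integrate
the extension. The $C^2$ case repeats this one order higher. -/
theorem exists_contDiff_one_extension {s : Set ℝ} (hs : Convex ℝ s) (hu : UniqueDiffOn ℝ s)
    (hcl : IsClosed s) (hne : s.Nonempty) {f : ℝ → ℝ} (hf : ContDiffOn ℝ 1 f s) :
    ∃ F : ℝ → ℝ, ContDiff ℝ 1 F ∧ EqOn F f s := by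
  obtain ⟨c, hc⟩ := hne
  obtain ⟨G, hG, hGf⟩ := exists_continuous_extension hcl
    (hf.continuousOn_derivWithin hu le_rfl)
  refine ⟨_, contDiff_one_of_hasDerivAt (fun x =>
    (hasDerivAt_integral_of_continuous hG c x).const_add (f c)) hG,
    eqOn_integral_of_eqOn_derivWithin hs hu (hf.differentiableOn (by norm_num)) hG hGf hc⟩

theorem exists_contDiff_two_extension {s : Set ℝ} (hs : Convex ℝ s) (hu : UniqueDiffOn ℝ s)
    (hcl : IsClosed s) (hne : s.Nonempty) {f : ℝ → ℝ} (hf : ContDiffOn ℝ 2 f s) :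
    ∃ F : ℝ → ℝ, ContDiff ℝ 2 F ∧ EqOn F f s := by
  obtain ⟨G, hG, hGf⟩ := exists_contDiff_one_extension hs hu hcl hne
    ((contDiffOn_succ_iff_derivWithin (n := 1) hu).1 hf).2.2
  obtain ⟨c, hc⟩ := hne
  refine ⟨_, contDiff_two_of_hasDerivAt (fun x =>
    (hasDerivAt_integral_of_continuous hG.continuous c x).const_add (f c)) hG,
    eqOn_integral_of_eqOn_derivWithin hs hu (hf.differentiableOn (by norm_num)) hG.continuous
      hGf hc⟩

/-- The function equal to `E` on `[0, ∞)` and to zero on `(-∞, 0)`. -/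
noncomputable def positivePart (E : ℝ → ℝ) (t : ℝ) : ℝ := if 0 ≤ t then E t else 0

theorem continuous_positivePart {E : ℝ → ℝ} (hE : Continuous E) (h0 : E 0 = 0) :
    Continuous (positivePart E) := by
  have : positivePart E = fun t => E (max t 0) := by
    ext t
    rcases le_or_gt 0 t with h | h
    · simp [positivePart, h]
    · simp [positivePart, not_le.2 h, max_eq_right h.le, h0]
  rw [this]; fun_prop

/-- Only $t=0$ needs an argument: there $E(t)=o(t)$, and the truncation is bounded by $|E|$. -/
theorem hasDerivAt_positivePart {E E₁ : ℝ → ℝ} (hE : ∀ t, HasDerivAt E (E₁ t) t)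
    (h0 : E 0 = 0) (h1 : E₁ 0 = 0) (t : ℝ) :
    HasDerivAt (positivePart E) (positivePart E₁ t) t := by
  rcases lt_trichotomy t 0 with h | h | h
  · rw [show positivePart E₁ t = 0 by simp [positivePart, h]]
    refine (hasDerivAt_const t (0 : ℝ)).congr_of_eventuallyEq ?_
    filter_upwards [Iio_mem_nhds h] with s hs
    simp only [mem_Iio] at hs
    simp [positivePart, hs]
  · subst h
    rw [show positivePart E₁ 0 = 0 by simp [positivePart, h1]]
    have := hE 0
    rw [h1] at this
    rw [hasDerivAt_iff_isLittleO] at this ⊢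
    refine Asymptotics.IsBigO.trans_isLittleO (Asymptotics.IsBigO.of_bound 1 ?_) this
    refine Eventually.of_forall fun s => ?_
    simp only [positivePart, h0]
    split_ifs <;> simp
  · rw [show positivePart E₁ t = E₁ t by simp [positivePart, h.le]]
    refine (hE t).congr_of_eventuallyEq ?_
    filter_upwards [Ioi_mem_nhds h] with s hs
    simp only [mem_Ioi] at hs
    simp [positivePart, hs.le]

/-- The matching conditions of orders zero, one and two at the left corner are exactly what this
lemma needs when applied to the boundary error. -/
theorem contDiff_two_positivePart {E : ℝ → ℝ} (hE : ContDiff ℝ 2 E)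
    (h0 : E 0 = 0) (h1 : deriv E 0 = 0) (h2 : deriv (deriv E) 0 = 0) :
    ContDiff ℝ 2 (positivePart E) := by
  refine contDiff_two_of_hasDerivAt
    (hasDerivAt_positivePart (hasDerivAt_of_contDiff_two hE) h0 h1) ?_
  exact contDiff_one_of_hasDerivAt
    (hasDerivAt_positivePart (hasDerivAt_deriv_of_contDiff_two hE) h1 h2)
    (continuous_positivePart (continuous_deriv_deriv hE) h2)

/-- Near each point the sequence is stationary from some index on, so the limit is locally one of
the $F_n$ and no uniform convergence is involved. -/
theorem exists_contDiff_two_limit {F : ℕ → ℝ → ℝ} {U : ℕ → Set ℝ} (hU : Monotone U)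
    (hcov : ∀ x, ∃ n, U n ∈ 𝓝 x) (hF : ∀ n, ContDiff ℝ 2 (F n))
    (hFU : ∀ n, EqOn (F (n + 1)) (F n) (U n)) :
    ∃ G : ℝ → ℝ, ContDiff ℝ 2 G ∧ ∀ n, EqOn G (F n) (U n) := by
  have key : ∀ n k, EqOn (F (n + k)) (F n) (U n) := by
    intro n k
    induction k with
    | zero => exact fun x _ => rfl
    | succ k ih => exact fun x hx => (hFU (n + k) (hU (Nat.le_add_right n k) hx)).trans (ih hx)
  have key' : ∀ n m x, x ∈ U n → x ∈ U m → F n x = F m x := by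
    intro n m x hn hm
    rcases le_total n m with h | h
    · obtain ⟨k, rfl⟩ := Nat.exists_eq_add_of_le h
      exact (key n k hn).symm
    · obtain ⟨k, rfl⟩ := Nat.exists_eq_add_of_le h
      exact key m k hm
  choose N hN using hcov
  have hG : ∀ n, EqOn (fun x => F (N x) x) (F n) (U n) := fun n x hx =>
    key' _ _ x (mem_of_mem_nhds (hN x)) hx
  refine ⟨fun x => F (N x) x, contDiff_iff_contDiffAt.2 fun x => ?_, hG⟩
  refine (hF (N x)).contDiffAt.congr_of_eventuallyEq ?_
  filter_upwards [hN x] with y hy using hG _ hy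

theorem exists_contDiff_two_inverse {G : ℝ → ℝ} (hG : ContDiff ℝ 2 G) (hd : ∀ t, 0 < deriv G t)
    (htop : Tendsto G atTop atTop) (hbot : Tendsto G atBot atBot) :
    ∃ Φ : ℝ → ℝ, ContDiff ℝ 2 Φ ∧ StrictMono Φ ∧ (∀ y, G (Φ y) = y) ∧ ∀ t, Φ (G t) = t := by
  have hm : StrictMono G := strictMono_of_deriv_pos hd
  have hsurj : Function.Surjective G := hG.continuous.surjective htop hbot
  let e : ℝ ≃o ℝ := hm.orderIsoOfSurjective G hsurj
  have he : ∀ t, e t = G t := fun t => rfl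
  refine ⟨e.symm, contDiff_iff_contDiffAt.2 fun y => ?_, e.symm.strictMono,
    fun y => e.apply_symm_apply y, fun t => e.symm_apply_apply t⟩
  exact e.toHomeomorph.toOpenPartialHomeomorph.contDiffAt_symm_deriv (hd _).ne' (mem_univ _)
    (hasDerivAt_of_contDiff_two hG _) hG.contDiffAt

/-- At an endpoint of $s$ the one-sided derivative already determines the full one, because both
functions are differentiable on the line. -/
theorem eqOn_deriv_of_eqOn {s : Set ℝ} (hu : UniqueDiffOn ℝ s) {f g : ℝ → ℝ}
    (hf : Differentiable ℝ f) (hg : Differentiable ℝ g) (h : EqOn f g s) :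
    EqOn (deriv f) (deriv g) s := by
  intro x hx
  rw [← (hf x).derivWithin (hu x hx), ← (hg x).derivWithin (hu x hx)]
  exact derivWithin_congr h (h hx)

theorem eqOn_deriv_deriv_of_eqOn {s : Set ℝ} (hu : UniqueDiffOn ℝ s) {f g : ℝ → ℝ}
    (hf : ContDiff ℝ 2 f) (hg : ContDiff ℝ 2 g) (h : EqOn f g s) :
    EqOn (deriv (deriv f)) (deriv (deriv g)) s :=
  eqOn_deriv_of_eqOn hu ((contDiff_one_deriv hf).differentiable (by norm_num))
    ((contDiff_one_deriv hg).differentiable (by norm_num))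
    (eqOn_deriv_of_eqOn hu (hf.differentiable (by norm_num)) (hg.differentiable (by norm_num)) h)

theorem derivWithin_eq_deriv_of_eqOn {s : Set ℝ} (hu : UniqueDiffOn ℝ s) {f F : ℝ → ℝ}
    (hF : Differentiable ℝ F) (h : EqOn f F s) {x : ℝ} (hx : x ∈ s) :
    derivWithin f s x = deriv F x := by
  rw [derivWithin_congr h (h hx), (hF x).derivWithin (hu x hx)]

theorem iteratedDerivWithin_two_eq_of_eqOn {s : Set ℝ} (hu : UniqueDiffOn ℝ s) {f F : ℝ → ℝ}
    (hF : ContDiff ℝ 2 F) (h : EqOn f F s) {x : ℝ} (hx : x ∈ s) :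
    iteratedDerivWithin 2 f s x = deriv (deriv F) x := by
  rw [iteratedDerivWithin_congr h hx,
    iteratedDerivWithin_eq_iteratedDeriv hu hF.contDiffAt hx, iteratedDeriv_succ, iteratedDeriv_one]

end Calculus

/-! ### Extension of the moving boundary to negative times, and inverses of $\gamma_\pm$. -/

section Curve

/-- A moving boundary of class `C²` on the whole line which stays slower than `a`. -/
structure SlowCurve (a l : ℝ) (Γ : ℝ → ℝ) : Prop where
  speed_pos : 0 < a
  length_pos : 0 < l
  zero : Γ 0 = 0
  lt : ∀ t, 0 ≤ t → Γ t < l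
  smooth : ContDiff ℝ 2 Γ
  neg_lt_deriv : ∀ t, -a < deriv Γ t
  deriv_lt : ∀ t, deriv Γ t < a
  plus_top : Tendsto (fun t => Γ t + a * t) atTop atTop
  minus_top : Tendsto (fun t => Γ t - a * t) atTop atBot
  plus_bot : Tendsto (fun t => Γ t + a * t) atBot atBot
  minus_bot : Tendsto (fun t => Γ t - a * t) atBot atTop

/-- A mere $C^2$ extension may become faster than $a$ for negative times. It is therefore replaced
there by an explicit function with the same 2-jet at $0$ and controlled slope, which makes
$\Gamma(t)\pm at$ bijections of the line. -/
theorem exists_slowCurve {a l : ℝ} (ha : 0 < a) (hl : 0 < l) {γ : ℝ → ℝ} (h0 : γ 0 = 0)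
    (hlt : ∀ t ∈ Ici (0 : ℝ), γ t < l)
    (hd : ∀ t ∈ Ici (0 : ℝ), derivWithin γ (Ici 0) t ∈ Ioo (-a) a)
    (hp : Tendsto (fun t => γ t + a * t) atTop atTop)
    (hm : Tendsto (fun t => γ t - a * t) atTop atBot) (hγ : ContDiffOn ℝ 2 γ (Ici 0)) :
    ∃ Γ : ℝ → ℝ, SlowCurve a l Γ ∧ EqOn γ Γ (Ici 0) := by
  have hu : UniqueDiffOn ℝ (Ici (0 : ℝ)) := uniqueDiffOn_Ici 0
  obtain ⟨Γ, hΓ, hΓγ⟩ := exists_contDiff_two_extension (convex_Ici 0) hu isClosed_Ici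
    nonempty_Ici hγ
  have hdΓ : ∀ t ∈ Ici (0 : ℝ), deriv Γ t ∈ Ioo (-a) a := fun t ht => by
    rw [← derivWithin_eq_deriv_of_eqOn hu (hΓ.differentiable (by norm_num)) hΓγ.symm ht]
    exact hd t ht
  set c := deriv Γ 0 with hc
  set e := deriv (deriv Γ) 0 with he
  have hc1 : |c| < a := abs_lt.2 (hdΓ 0 self_mem_Ici)
  -- The room left between $|\gamma'(0)|$ and $a$. Below, $K$ is so large that $|e|/K\le\delta$: the
  -- oscillating term then realises the second derivative $e$ at $0$ while changing the slope by at
  -- most $\delta$.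
  obtain ⟨δ, hδ0, hδ⟩ : ∃ δ, 0 < δ ∧ |c| + δ < a := ⟨(a - |c|) / 2, by linarith, by linarith⟩
  set K := (|e| + 1) / δ with hK
  have hK0 : 0 < K := by positivity
  have heK : ∀ s, |e * (Real.sin (K * s) / K)| ≤ δ := fun s => by
    rw [abs_mul, abs_div, abs_of_pos hK0, hK, div_div_eq_mul_div, ← mul_div_assoc,
      div_le_iff₀ (by positivity)]
    have := Real.abs_sin_le_one ((|e| + 1) / δ * s)
    have h2 : |e| * (|Real.sin ((|e| + 1) / δ * s)| * δ) ≤ |e| * (1 * δ) := by gcongr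
    nlinarith
  -- the extension to negative times, with bounded slope
  set N : ℝ → ℝ := fun t => c * t + e * ((1 - Real.cos (K * t)) / K ^ 2) with hN
  set N₁ : ℝ → ℝ := fun t => c + e * (Real.sin (K * t) / K) with hN₁
  set N₂ : ℝ → ℝ := fun t => e * Real.cos (K * t) with hN₂
  have hNd : ∀ t, HasDerivAt N (N₁ t) t := fun t => by
    have h1 : HasDerivAt (fun t => K * t) K t := by simpa using (hasDerivAt_id t).const_mul K
    have h2 := (((h1.cos).const_sub 1).div_const (K ^ 2)).const_mul e
    have h3 := ((hasDerivAt_id t).const_mul c).add h2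
    refine h3.congr_deriv ?_
    simp only [hN₁]; field_simp
  have hNd2 : ∀ t, HasDerivAt N₁ (N₂ t) t := fun t => by
    have h1 : HasDerivAt (fun t => K * t) K t := by simpa using (hasDerivAt_id t).const_mul K
    refine (((h1.sin).div_const K).const_mul e |>.const_add c).congr_deriv ?_
    simp only [hN₂]; field_simp
  have hNc : ContDiff ℝ 2 N := contDiff_two_of_hasDerivAt hNd
    (contDiff_one_of_hasDerivAt hNd2 (by simp only [hN₂]; fun_prop))
  have hN1 : deriv N = N₁ := funext fun t => (hNd t).deriv
  have hN2 : deriv (deriv N) = N₂ := by rw [hN1]; exact funext fun t => (hNd2 t).deriv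
  have hE : ContDiff ℝ 2 (fun t => Γ t - N t) := hΓ.sub hNc
  have hE1 : deriv (fun t => Γ t - N t) = fun t => deriv Γ t - N₁ t := funext fun t =>
    ((hasDerivAt_of_contDiff_two hΓ t).sub (hNd t)).deriv
  have hE2 : deriv (deriv (fun t => Γ t - N t)) = fun t => deriv (deriv Γ) t - N₂ t := by
    rw [hE1]
    exact funext fun t => ((hasDerivAt_deriv_of_contDiff_two hΓ t).sub (hNd2 t)).deriv
  have hΓ0 : Γ 0 = 0 := by rw [hΓγ self_mem_Ici, h0]
  have hz0 : Γ 0 - N 0 = 0 := by simp [hΓ0, hN]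
  have hz1 : deriv Γ 0 - N₁ 0 = 0 := by simp [hN₁, hc]
  have hz2 : deriv (deriv Γ) 0 - N₂ 0 = 0 := by simp [hN₂, he]
  have hP : ContDiff ℝ 2 (positivePart fun t => Γ t - N t) :=
    contDiff_two_positivePart hE hz0 (by rw [hE1]; exact hz1) (by rw [hE2]; exact hz2)
  have hPd : ∀ t, HasDerivAt (positivePart fun t => Γ t - N t)
      (positivePart (fun t => deriv Γ t - N₁ t) t) t :=
    hasDerivAt_positivePart (fun t => (hasDerivAt_of_contDiff_two hΓ t).sub (hNd t)) hz0 hz1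
  -- $\Gamma-N$ has zero 2-jet at $0$, so the function equal to $N$ before time $0$ and to $\Gamma$
  -- after it is $C^2$.
  set G : ℝ → ℝ := fun t => N t + positivePart (fun t => Γ t - N t) t with hG
  have hGpos : ∀ t, 0 ≤ t → G t = Γ t := fun t ht => by simp [hG, positivePart, ht]
  have hGneg : ∀ t, t ≤ 0 → G t = N t := fun t ht => by
    rcases ht.lt_or_eq with h | h
    · simp [hG, positivePart, not_le.2 h]
    · subst h; rw [hGpos 0 le_rfl]; linarith
  have hGγ : EqOn γ G (Ici 0) := fun t ht => by rw [hGpos t ht, hΓγ ht]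
  have hGd : ∀ t, deriv G t = N₁ t + positivePart (fun t => deriv Γ t - N₁ t) t := fun t =>
    ((hNd t).add (hPd t)).deriv
  have hN₁a : ∀ t, |N₁ t| < a := fun t =>
    (abs_add_le _ _).trans_lt ((add_le_add_right (heK t) _).trans_lt hδ)
  have hGda : ∀ t, -a < deriv G t ∧ deriv G t < a := fun t => by
    rw [hGd]
    rcases le_or_gt 0 t with h | h
    · simpa [positivePart, h] using hdΓ t h
    · simpa [positivePart, not_le.2 h] using abs_lt.1 (hN₁a t)
  have hcos : ∀ t, |e * ((1 - Real.cos (K * t)) / K ^ 2)| ≤ |e| * 2 / K ^ 2 := fun t => by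
    rw [abs_mul, abs_div, abs_of_pos (pow_pos hK0 2), ← mul_div_assoc]
    have : |1 - Real.cos (K * t)| ≤ 2 := by
      rw [abs_le]; constructor <;> linarith [Real.neg_one_le_cos (K * t), Real.cos_le_one (K * t)]
    gcongr
  refine ⟨G, ⟨ha, hl, by rw [← hGγ self_mem_Ici, h0], fun t ht => by rw [← hGγ ht]; exact hlt t ht,
    hNc.add hP, fun t => (hGda t).1, fun t => (hGda t).2, ?_, ?_, ?_, ?_⟩, hGγ⟩
  · refine hp.congr' ?_
    filter_upwards [Ici_mem_atTop (0 : ℝ)] with t ht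
    rw [hGγ ht]
  · refine hm.congr' ?_
    filter_upwards [Ici_mem_atTop (0 : ℝ)] with t ht
    rw [hGγ ht]
  -- The cosine term is bounded, so the linear term, of slope $c+a>0$ here and $c-a<0$ in the next
  -- case, decides the limit.
  · have h1 : Tendsto (fun t : ℝ => |e| * 2 / K ^ 2 + (c + a) * t) atBot atBot :=
      tendsto_atBot_add_const_left _ _
        (tendsto_id.const_mul_atBot (by linarith [(abs_lt.1 hc1).1]))
    refine tendsto_atBot_mono' _ ?_ h1
    filter_upwards [Iic_mem_atBot (0 : ℝ)] with t ht
    rw [hGneg t ht]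
    simp only [hN]
    linarith [le_of_abs_le (hcos t)]
  · have h1 : Tendsto (fun t : ℝ => -(|e| * 2 / K ^ 2) + (c - a) * t) atBot atTop :=
      tendsto_atTop_add_const_left _ _
        (tendsto_id.const_mul_atBot_of_neg (by linarith [(abs_lt.1 hc1).2]))
    refine tendsto_atTop_mono' _ ?_ h1
    filter_upwards [Iic_mem_atBot (0 : ℝ)] with t ht
    rw [hGneg t ht]
    simp only [hN]
    linarith [neg_le_of_abs_le (hcos t)]

namespace SlowCurve

variable {a l : ℝ} {Γ : ℝ → ℝ}

theorem hasDerivAt (h : SlowCurve a l Γ) (t : ℝ) : HasDerivAt Γ (deriv Γ t) t :=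
  hasDerivAt_of_contDiff_two h.smooth t

theorem hasDerivAt_plus (h : SlowCurve a l Γ) (t : ℝ) :
    HasDerivAt (fun t => Γ t + a * t) (deriv Γ t + a) t := by
  simpa using (h.hasDerivAt t).fun_add ((hasDerivAt_id t).const_mul a)

theorem hasDerivAt_minus (h : SlowCurve a l Γ) (t : ℝ) :
    HasDerivAt (fun t => Γ t - a * t) (deriv Γ t - a) t := by
  simpa using (h.hasDerivAt t).fun_sub ((hasDerivAt_id t).const_mul a)

theorem strictMono_plus (h : SlowCurve a l Γ) : StrictMono fun t => Γ t + a * t :=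
  strictMono_of_deriv_pos fun t => by
    rw [(h.hasDerivAt_plus t).deriv]; linarith [h.neg_lt_deriv t]

theorem strictAnti_minus (h : SlowCurve a l Γ) : StrictAnti fun t => Γ t - a * t :=
  strictAnti_of_deriv_neg fun t => by
    rw [(h.hasDerivAt_minus t).deriv]; linarith [h.deriv_lt t]

theorem exists_plus_inverse (h : SlowCurve a l Γ) :
    ∃ Φ : ℝ → ℝ, ContDiff ℝ 2 Φ ∧ StrictMono Φ ∧ (∀ y, Γ (Φ y) + a * Φ y = y) ∧
      ∀ t, Φ (Γ t + a * t) = t :=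
  exists_contDiff_two_inverse (h.smooth.add (contDiff_const.mul contDiff_id))
    (fun t => by
      rw [show deriv (fun x => Γ x + a * id x) t = _ from (h.hasDerivAt_plus t).deriv]
      linarith [h.neg_lt_deriv t]) h.plus_top h.plus_bot

theorem exists_minus_inverse (h : SlowCurve a l Γ) :
    ∃ Φ : ℝ → ℝ, ContDiff ℝ 2 Φ ∧ StrictAnti Φ ∧ (∀ z, Γ (Φ z) - a * Φ z = z) ∧
      ∀ t, Φ (Γ t - a * t) = t := by
  obtain ⟨Φ, h1, h2, h3, h4⟩ := exists_contDiff_two_inverse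
    (G := fun t => -(Γ t - a * t)) (h.smooth.sub (contDiff_const.mul contDiff_id)).neg
    (fun t => by
      rw [(h.hasDerivAt_minus t).fun_neg.deriv]
      linarith [h.deriv_lt t]) (tendsto_neg_atBot_atTop.comp h.minus_top)
      (tendsto_neg_atTop_atBot.comp h.minus_bot)
  refine ⟨fun z => Φ (-z), h1.comp contDiff_neg, fun x y hxy => h2 (neg_lt_neg hxy),
    fun z => ?_, fun t => h4 t⟩
  have := h3 (-z)
  linarith

end SlowCurve

end Curve

/-! ### The closed strip and the reflection nodes. -/

section Geometry

/-- The closed curvilinear half-strip. -/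
def strip (l : ℝ) (Γ : ℝ → ℝ) : Set (ℝ × ℝ) :=
  {q | 0 ≤ q.1 ∧ Γ q.1 ≤ q.2 ∧ q.2 ≤ l}

variable {a l : ℝ} {Γ γ : ℝ → ℝ}

theorem halfStrip_congr (hγ : EqOn γ Γ (Ici 0)) : halfStrip l γ = halfStrip l Γ := by
  ext q
  simp only [halfStrip, mem_ofPred_eq]
  refine and_congr_right fun hq => ?_
  rw [hγ (mem_Ici.2 hq.le)]

theorem isOpen_halfStrip (hΓ : Continuous Γ) : IsOpen (halfStrip l Γ) :=
  (isOpen_lt continuous_const continuous_fst).inter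
    ((isOpen_lt (hΓ.comp continuous_fst) continuous_snd).inter
      (isOpen_lt continuous_snd continuous_const))

theorem isClosed_strip (hΓ : Continuous Γ) : IsClosed (strip l Γ) :=
  (isClosed_le continuous_const continuous_fst).inter
    ((isClosed_le (hΓ.comp continuous_fst) continuous_snd).inter
      (isClosed_le continuous_snd continuous_const))

theorem halfStrip_subset_strip : halfStrip l Γ ⊆ strip l Γ :=
  fun _ hq => ⟨hq.1.le, hq.2.1.le, hq.2.2.le⟩

namespace SlowCurve

theorem continuous (h : SlowCurve a l Γ) : Continuous Γ := h.smooth.continuous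

/-- Every point of the strip lies in a convex body contained in the strip, namely the part of the
strip reached from `(t, Γ t)` with speed at most `a`. -/
theorem exists_convex_subset_strip (h : SlowCurve a l Γ) {q : ℝ × ℝ} (hq : q ∈ strip l Γ) :
    ∃ K : Set (ℝ × ℝ), Convex ℝ K ∧ (interior K).Nonempty ∧ q ∈ K ∧ K ⊆ strip l Γ ∧
      interior K ⊆ halfStrip l Γ := by
  obtain ⟨t, x⟩ := q
  obtain ⟨h1, h2, h3⟩ := hq
  simp only at h1 h2 h3
  have hmono : ∀ s, t ≤ s → Γ s ≤ Γ t + a * (s - t) := fun s hs => by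
    have := h.strictAnti_minus.antitone hs
    beta_reduce at this
    linarith
  have hmono' : ∀ s, t < s → Γ s < Γ t + a * (s - t) := fun s hs => by
    have := h.strictAnti_minus hs
    beta_reduce at this
    linarith
  have ha := h.speed_pos
  -- An open triangle between the line of slope $a$ issuing from $(t,\Gamma(t))$ and $x=l$. The
  -- curve is slower than $a$, so it stays below the triangle.
  set O : Set (ℝ × ℝ) := {q | t < q.1 ∧ Γ t + a * (q.1 - t) < q.2 ∧ q.2 < l} with hO
  have hOo : IsOpen O :=
    (isOpen_lt continuous_const continuous_fst).inter
      ((isOpen_lt (by fun_prop) continuous_snd).inter (isOpen_lt continuous_snd continuous_const))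
  have hOc : Convex ℝ O := by
    rintro ⟨t₁, x₁⟩ ⟨a1, a2, a3⟩ ⟨t₂, x₂⟩ ⟨b1, b2, b3⟩ c d hc hd hcd
    simp only at a1 a2 a3 b1 b2 b3
    have hd' : d = 1 - c := by linarith
    subst hd'
    simp only [hO, mem_ofPred_eq, Prod.smul_mk, Prod.mk_add_mk, smul_eq_mul]
    rcases hc.eq_or_lt with rfl | hc
    · simp [b1, b2, b3]
    · refine ⟨?_, ?_, ?_⟩ <;> nlinarith
  have hOn : O.Nonempty := by
    have hl := h.lt t h1
    -- By this time the line of slope $a$ has climbed a quarter of the gap $l-\Gamma(t)$; the chosen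
    -- point is half-way up.
    refine ⟨(t + (l - Γ t) / (4 * a), (Γ t + l) / 2), ?_, ?_, ?_⟩
    · simp only; have : 0 < (l - Γ t) / (4 * a) := by apply div_pos <;> linarith
      linarith
    · simp only; have : a * (t + (l - Γ t) / (4 * a) - t) = (l - Γ t) / 4 := by field_simp; ring
      rw [this]; linarith
    · simp only; linarith
  have hsub : O ⊆ halfStrip l Γ := fun p hp =>
    ⟨h1.trans_lt hp.1, (hmono' _ hp.1).trans hp.2.1, hp.2.2⟩
  have hclO : closure O ⊆ strip l Γ :=
    closure_minimal (hsub.trans halfStrip_subset_strip) (isClosed_strip h.continuous)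
  have hintO : interior (closure O) = O := by
    rw [hOc.interior_closure_eq_interior_of_nonempty_interior (by rwa [hOo.interior_eq]),
      hOo.interior_eq]
  refine ⟨closure O, hOc.closure, by rwa [hintO], ?_, hclO, by rwa [hintO]⟩
  obtain ⟨⟨t₁, x₁⟩, b1, b2, b3⟩ := hOn
  simp only at b1 b2 b3
  -- The point $q$ lies on the side of the triangle at time $t$; the segment from $q$ to a point of
  -- $O$ enters $O$ at once.
  have hlim : Tendsto (fun s : ℝ => (t + s * (t₁ - t), x + s * (x₁ - x))) (𝓝[>] 0)
      (𝓝 (t, x)) := by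
    have : Continuous fun s : ℝ => (t + s * (t₁ - t), x + s * (x₁ - x)) := by fun_prop
    have h0 := this.tendsto 0
    simp only [zero_mul, add_zero] at h0
    exact h0.mono_left nhdsWithin_le_nhds
  refine mem_closure_of_tendsto hlim ?_
  filter_upwards [Ioo_mem_nhdsGT (show (0 : ℝ) < 1 by norm_num)] with s hs
  obtain ⟨s0, s1⟩ := hs
  refine ⟨?_, ?_, ?_⟩ <;> simp only <;> nlinarith [mul_pos s0 (sub_pos.2 b1)]

theorem closure_halfStrip (h : SlowCurve a l Γ) : closure (halfStrip l Γ) = strip l Γ := by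
  refine (closure_minimal halfStrip_subset_strip (isClosed_strip h.continuous)).antisymm
    fun q hq => ?_
  obtain ⟨K, hK, hKi, hqK, -, hKQ⟩ := h.exists_convex_subset_strip hq
  refine closure_mono hKQ ?_
  rw [hK.closure_interior_eq_closure_of_nonempty_interior hKi]
  exact subset_closure hqK

/-- The strip itself need not be convex; unique differentiability is inherited at each point from a
convex body inside it. It is what makes `dt` and `dx` determinate on the boundary. -/
theorem uniqueDiffOn_strip (h : SlowCurve a l Γ) : UniqueDiffOn ℝ (strip l Γ) := fun q hq => by
  obtain ⟨K, hK, hKi, hqK, hKS, -⟩ := h.exists_convex_subset_strip hq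
  exact (uniqueDiffWithinAt_convex hK hKi (subset_closure hqK)).mono hKS

theorem mem_strip_initial (h : SlowCurve a l Γ) {x : ℝ} (hx : x ∈ Icc 0 l) :
    ((0, x) : ℝ × ℝ) ∈ strip l Γ := ⟨le_rfl, by simpa [h.zero] using hx.1, hx.2⟩

theorem mem_strip_left (h : SlowCurve a l Γ) {t : ℝ} (ht : 0 ≤ t) :
    ((t, Γ t) : ℝ × ℝ) ∈ strip l Γ := ⟨ht, le_rfl, (h.lt t ht).le⟩

theorem mem_strip_right (h : SlowCurve a l Γ) {t : ℝ} (ht : 0 ≤ t) :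
    ((t, l) : ℝ × ℝ) ∈ strip l Γ := ⟨ht, (h.lt t ht).le, le_rfl⟩

theorem sub_le_of_mem_strip (h : SlowCurve a l Γ) {q : ℝ × ℝ} (hq : q ∈ strip l Γ) :
    q.2 - a * q.1 ≤ l := by
  have := mul_nonneg h.speed_pos.le hq.1
  linarith [hq.2.2]

theorem add_nonneg_of_mem_strip (h : SlowCurve a l Γ) {q : ℝ × ℝ} (hq : q ∈ strip l Γ) :
    0 ≤ q.2 + a * q.1 := by
  have := h.strictMono_plus.monotone hq.1
  beta_reduce at this
  rw [h.zero] at this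
  linarith [hq.2.1]

end SlowCurve

/-- The times `r` and the abscissae `L` at which the characteristics reflect. -/
structure CharNodes (a l : ℝ) (Γ : ℝ → ℝ) (r L : ℕ → ℝ) : Prop where
  r_zero : r 0 = 0
  L_zero : L 0 = l
  r_nonneg : ∀ n, 0 ≤ r n
  L_succ : ∀ n, L (n + 1) = 2 * l - (Γ (r n) - a * r n)
  r_succ : ∀ n, Γ (r (n + 1)) + a * r (n + 1) = L n

namespace CharNodes

variable {r L : ℕ → ℝ}

/-- The two recurrences feed each other: $r_n<r_{n+1}$ yields $L_{n+1}<L_{n+2}$ since $\gamma_-$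
decreases, and $L_n<L_{n+1}$ yields $r_{n+1}<r_{n+2}$ since $\gamma_+$ increases. -/
theorem lt_succ (hn : CharNodes a l Γ r L) (h : SlowCurve a l Γ) (n : ℕ) :
    r n < r (n + 1) ∧ L n < L (n + 1) := by
  have key : ∀ n, r n < r (n + 1) → L (n + 1) < L (n + 2) := fun n h1 => by
    have := h.strictAnti_minus h1
    beta_reduce at this
    rw [hn.L_succ, hn.L_succ]; linarith
  have key' : ∀ n, L n < L (n + 1) → r (n + 1) < r (n + 2) := fun n h1 => by
    rw [← hn.r_succ, ← hn.r_succ] at h1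
    exact h.strictMono_plus.lt_iff_lt.1 h1
  have hr0 : r 0 < r 1 := by
    have h1 := hn.r_succ 0
    rw [hn.L_zero] at h1
    refine h.strictMono_plus.lt_iff_lt.1 ?_
    rw [h1, hn.r_zero, h.zero]; linarith [h.length_pos]
  have hL0 : L 0 < L 1 := by
    rw [hn.L_succ, hn.L_zero, hn.r_zero, h.zero]; linarith [h.length_pos]
  induction n with
  | zero => exact ⟨hr0, hL0⟩
  | succ n ih => exact ⟨key' n ih.2, key n ih.1⟩

theorem strictMono_r (hn : CharNodes a l Γ r L) (h : SlowCurve a l Γ) : StrictMono r :=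
  strictMono_nat_of_lt_succ fun n => (hn.lt_succ h n).1

theorem strictMono_L (hn : CharNodes a l Γ r L) (h : SlowCurve a l Γ) : StrictMono L :=
  strictMono_nat_of_lt_succ fun n => (hn.lt_succ h n).2

/-- If $r_n\to r'$, the two recurrences give $\Gamma(r')+ar'=2l-\Gamma(r')+ar'$ in the limit, hence
$\Gamma(r')=l$: the curve would touch the wall. -/
theorem tendsto_r (hn : CharNodes a l Γ r L) (h : SlowCurve a l Γ) : Tendsto r atTop atTop := by
  rcases tendsto_atTop_of_monotone (hn.strictMono_r h).monotone with h1 | ⟨r', h1⟩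
  · exact h1
  exfalso
  have hc := h.continuous
  have h2 := h1.comp (tendsto_add_atTop_nat 1)
  have h3 : Tendsto L atTop (𝓝 (Γ r' + a * r')) := by
    have : Continuous fun t => Γ t + a * t := by fun_prop
    refine ((this.tendsto r').comp h2).congr fun n => hn.r_succ n
  have h4 : Tendsto (fun n => L (n + 1)) atTop (𝓝 (2 * l - (Γ r' - a * r'))) := by
    have : Continuous fun t => 2 * l - (Γ t - a * t) := by fun_prop
    exact ((this.tendsto r').comp h1).congr fun n => (hn.L_succ n).symm
  have h5 := tendsto_nhds_unique (h3.comp (tendsto_add_atTop_nat 1)) h4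
  have h6 : 0 ≤ r' := ge_of_tendsto' h1 hn.r_nonneg
  linarith [h.lt r' h6]

theorem tendsto_L (hn : CharNodes a l Γ r L) (h : SlowCurve a l Γ) : Tendsto L atTop atTop :=
  (h.plus_top.comp ((hn.tendsto_r h).comp (tendsto_add_atTop_nat 1))).congr fun n => hn.r_succ n

theorem tendsto_minus (hn : CharNodes a l Γ r L) (h : SlowCurve a l Γ) :
    Tendsto (fun n => Γ (r n) - a * r n) atTop atBot := h.minus_top.comp (hn.tendsto_r h)

theorem strictAnti_minus (hn : CharNodes a l Γ r L) (h : SlowCurve a l Γ) :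
    StrictAnti fun n => Γ (r n) - a * r n := h.strictAnti_minus.comp_strictMono (hn.strictMono_r h)

end CharNodes

theorem SlowCurve.charNodes (h : SlowCurve a l Γ) (hγ : EqOn γ Γ (Ici 0)) :
    CharNodes a l Γ (rNode a l γ) (fun n => l + a * lNode a l γ n) := by
  have ha := h.speed_pos
  obtain ⟨Φ, -, hΦm, hΦ, hΦ'⟩ := h.exists_plus_inverse
  have hΦ0 : Φ 0 = 0 := by simpa [h.zero] using hΦ' 0
  have key : ∀ y, 0 ≤ y → 0 ≤ phiPlus a γ y ∧ Γ (phiPlus a γ y) + a * phiPlus a γ y = y := by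
    intro y hy
    have hex : ∃ t ∈ Ici (0 : ℝ), gammaPlus a γ t = y := by
      have h0 : 0 ≤ Φ y := hΦ0 ▸ hΦm.monotone hy
      exact ⟨Φ y, h0, by rw [gammaPlus, hγ (mem_Ici.2 h0), hΦ]⟩
    have h1 : 0 ≤ phiPlus a γ y := Function.invFunOn_mem hex
    have h2 : gammaPlus a γ (phiPlus a γ y) = y := Function.invFunOn_eq hex
    refine ⟨h1, ?_⟩
    rwa [gammaPlus, hγ (mem_Ici.2 h1)] at h2
  -- `phiPlus` is an inverse only for arguments attained at nonnegative times, so $r_{n+1}$ can be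
  -- controlled only once $l_n\ge0$ is known; both signs are carried together.
  have hnn : ∀ n, 0 ≤ rNode a l γ n ∧ 0 ≤ lNode a l γ n := by
    intro n
    induction n with
    | zero => simp [rNode, lNode, nodes]
    | succ n ih =>
      obtain ⟨h1, h2⟩ := ih
      constructor
      · exact (key (l + a * lNode a l γ n) (by have := h.length_pos; positivity)).1
      · have h3 : γ (rNode a l γ n) < l := by rw [hγ (mem_Ici.2 h1)]; exact h.lt _ h1
        have : lNode a l γ (n + 1) = rNode a l γ n + (l - γ (rNode a l γ n)) / a := rfl
        rw [this]
        have : 0 < (l - γ (rNode a l γ n)) / a := div_pos (by linarith) ha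
        linarith
  refine ⟨rfl, by simp [lNode, nodes], fun n => (hnn n).1, fun n => ?_, fun n => ?_⟩
  · have : lNode a l γ (n + 1) = rNode a l γ n + (l - γ (rNode a l γ n)) / a := rfl
    rw [this, hγ (mem_Ici.2 (hnn n).1)]
    field_simp
    ring
  · have h2 := (hnn n).2
    exact (key (l + a * lNode a l γ n) (by have := h.length_pos; positivity)).2

/-! ### The cells and the covering of the closed strip. -/

section Cells

theorem gammaMinus_rNode (h : SlowCurve a l Γ) (hγ : EqOn γ Γ (Ici 0)) (n : ℕ) :
    gammaMinus a γ (rNode a l γ n) = Γ (rNode a l γ n) - a * rNode a l γ n := by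
  rw [gammaMinus, hγ (mem_Ici.2 ((h.charNodes hγ).r_nonneg n))]

theorem exists_mem_gDom (h : SlowCurve a l Γ) (hγ : EqOn γ Γ (Ici 0)) {z : ℝ} (hz : z ≤ l) :
    ∃ i, z ∈ gDom a l γ i := by
  have hn := h.charNodes hγ
  by_cases h0 : 0 ≤ z
  · exact ⟨0, h0, hz⟩
  have hex : ∃ n, gammaMinus a γ (rNode a l γ n) ≤ z := by
    obtain ⟨n, hn⟩ := ((hn.tendsto_minus h).eventually_le_atBot z).exists
    exact ⟨n, by rwa [gammaMinus_rNode h hγ]⟩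
  classical
  have h1 := Nat.find_spec hex
  have h2 := fun m => Nat.find_min hex (m := m)
  generalize Nat.find hex = n at h1 h2
  cases n with
  | zero =>
    rw [gammaMinus_rNode h hγ, hn.r_zero, h.zero] at h1
    exact absurd (by simpa using h1) h0
  | succ n => exact ⟨n + 1, h1, (not_le.1 (h2 n (Nat.lt_succ_self n))).le⟩

theorem exists_mem_pDom (h : SlowCurve a l Γ) (hγ : EqOn γ Γ (Ici 0)) {y : ℝ} (hy : 0 ≤ y) :
    ∃ j, y ∈ pDom a l γ j := by
  have hn := h.charNodes hγ
  have hL0 := hn.L_zero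
  beta_reduce at hL0
  by_cases h0 : y ≤ l
  · exact ⟨0, hy, h0⟩
  have hex : ∃ n, y ≤ l + a * lNode a l γ n := ((hn.tendsto_L h).eventually_ge_atTop y).exists
  classical
  have h1 := Nat.find_spec hex
  have h2 := fun m => Nat.find_min hex (m := m)
  generalize Nat.find hex = n at h1 h2
  cases n with
  | zero => exact absurd (hL0 ▸ h1) h0
  | succ n => exact ⟨n + 1, (not_le.1 (h2 n (Nat.lt_succ_self n))).le, h1⟩

theorem isClosed_gDom (i : ℕ) : IsClosed (gDom a l γ i) := by
  cases i <;> exact isClosed_Icc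

theorem isClosed_pDom (j : ℕ) : IsClosed (pDom a l γ j) := by
  cases j <;> exact isClosed_Icc

theorem mem_of_mem_closure_cell (h : SlowCurve a l Γ) (hγ : EqOn γ Γ (Ici 0)) {i j : ℕ}
    {q : ℝ × ℝ} (hq : q ∈ closure (cell a l γ i j)) :
    q ∈ strip l Γ ∧ q.2 - a * q.1 ∈ gDom a l γ i ∧ q.2 + a * q.1 ∈ pDom a l γ j := by
  have hcl : IsClosed {q : ℝ × ℝ | q ∈ strip l Γ ∧ q.2 - a * q.1 ∈ gDom a l γ i ∧
      q.2 + a * q.1 ∈ pDom a l γ j} :=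
    (isClosed_strip h.continuous).inter
      (((isClosed_gDom i).preimage (by fun_prop)).inter ((isClosed_pDom j).preimage (by fun_prop)))
  refine closure_minimal (fun p hp => ?_) hcl hq
  exact ⟨halfStrip_subset_strip (halfStrip_congr hγ ▸ hp.1), hp.2⟩

/-- The end points of $G_i$ tend to $-\infty$ and those of $P_j$ to $+\infty$, so a neighbourhood on
which $x\pm at$ vary by less than one meets finitely many cells. Local finiteness lets closure pass
through the union. -/
theorem locallyFinite_cell (h : SlowCurve a l Γ) (hγ : EqOn γ Γ (Ici 0)) :
    LocallyFinite fun ij : ℕ × ℕ => cell a l γ ij.1 ij.2 := by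
  intro q
  have hn := h.charNodes hγ
  obtain ⟨N, hN⟩ := ((hn.tendsto_minus h).eventually_le_atBot (q.2 - a * q.1 - 1)).exists
  obtain ⟨M, hM⟩ := ((hn.tendsto_L h).eventually_ge_atTop (q.2 + a * q.1 + 1)).exists
  refine ⟨{p | q.2 - a * q.1 - 1 < p.2 - a * p.1 ∧ p.2 + a * p.1 < q.2 + a * q.1 + 1},
    IsOpen.mem_nhds (IsOpen.and (isOpen_lt (by fun_prop) (by fun_prop))
      (isOpen_lt (by fun_prop) (by fun_prop))) ⟨by linarith, by linarith⟩,
    (finite_Iic (N, M)).subset ?_⟩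
  rintro ⟨i, j⟩ ⟨p, ⟨-, hp1, hp2⟩, hp3, hp4⟩
  simp only at hp1 hp2
  refine ⟨?_, ?_⟩
  · by_contra hlt
    simp only [not_le] at hlt
    -- The index shift matters: $G_{k+1}$ ends on the right at $\gamma_-(r_k)$ with $k\ge N$, which
    -- already lies below the neighbourhood.
    obtain ⟨k, rfl⟩ : ∃ k, i = k + 1 := ⟨i - 1, by omega⟩
    have h1 := hp1.2
    rw [gammaMinus_rNode h hγ] at h1
    have h2 := (hn.strictAnti_minus h).antitone (Nat.lt_succ_iff.1 hlt)
    beta_reduce at h2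
    linarith
  · by_contra hlt
    simp only [not_le] at hlt
    obtain ⟨k, rfl⟩ : ∃ k, j = k + 1 := ⟨j - 1, by omega⟩
    have h1 := hp2.1
    have h2 := (hn.strictMono_L h).monotone (Nat.lt_succ_iff.1 hlt)
    beta_reduce at h2
    linarith

theorem closure_halfStrip_eq_iUnion (h : SlowCurve a l Γ) (hγ : EqOn γ Γ (Ici 0)) :
    closure (halfStrip l γ) = ⋃ (i : ℕ) (j : ℕ), closure (cell a l γ i j) := by
  have h1 : halfStrip l γ = ⋃ ij : ℕ × ℕ, cell a l γ ij.1 ij.2 := by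
    refine Subset.antisymm (fun q hq => ?_) (iUnion_subset fun ij q hq => hq.1)
    have hq' := halfStrip_subset_strip (halfStrip_congr hγ ▸ hq)
    obtain ⟨i, hi⟩ := exists_mem_gDom h hγ (h.sub_le_of_mem_strip hq')
    obtain ⟨j, hj⟩ := exists_mem_pDom h hγ (h.add_nonneg_of_mem_strip hq')
    exact mem_iUnion.2 ⟨(i, j), hq, hi, hj⟩
  rw [h1, (locallyFinite_cell h hγ).closure_iUnion, iUnion_prod']

end Cells

end Geometry

/-! ### Partial derivatives in the plane and travelling waves. -/

section Plane

/-- The linear form `(t, x) ↦ c t + d x`. -/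
noncomputable def gradCLM (c d : ℝ) : ℝ × ℝ →L[ℝ] ℝ :=
  c • ContinuousLinearMap.fst ℝ ℝ ℝ + d • ContinuousLinearMap.snd ℝ ℝ ℝ

@[simp] theorem gradCLM_apply (c d : ℝ) (q : ℝ × ℝ) : gradCLM c d q = c * q.1 + d * q.2 := by
  simp [gradCLM]

theorem eq_gradCLM (A : ℝ × ℝ →L[ℝ] ℝ) : A = gradCLM (A (1, 0)) (A (0, 1)) := by
  ext <;> simp

theorem hasFDerivWithinAt_gradCLM {S : Set (ℝ × ℝ)} {u : ℝ × ℝ → ℝ} {q : ℝ × ℝ}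
    (hu : DifferentiableWithinAt ℝ u S q) :
    HasFDerivWithinAt u (gradCLM (dt S u q) (dx S u q)) S q := by
  have := hu.hasFDerivWithinAt
  rwa [eq_gradCLM (fderivWithin ℝ u S q)] at this

theorem hasFDerivAt_gradCLM {u : ℝ × ℝ → ℝ} {q : ℝ × ℝ} (hu : DifferentiableAt ℝ u q) :
    HasFDerivAt u (gradCLM (dt univ u q) (dx univ u q)) q :=
  hasFDerivWithinAt_univ.1 (hasFDerivWithinAt_gradCLM hu.differentiableWithinAt)

theorem dt_eq_of_hasFDerivWithinAt {S : Set (ℝ × ℝ)} {u : ℝ × ℝ → ℝ} {q : ℝ × ℝ} {c d : ℝ}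
    (hS : UniqueDiffWithinAt ℝ S q) (h : HasFDerivWithinAt u (gradCLM c d) S q) :
    dt S u q = c := by
  simp [dt, h.fderivWithin hS]

theorem dx_eq_of_hasFDerivWithinAt {S : Set (ℝ × ℝ)} {u : ℝ × ℝ → ℝ} {q : ℝ × ℝ} {c d : ℝ}
    (hS : UniqueDiffWithinAt ℝ S q) (h : HasFDerivWithinAt u (gradCLM c d) S q) :
    dx S u q = d := by
  simp [dx, h.fderivWithin hS]

theorem dt_univ_eq {u : ℝ × ℝ → ℝ} {q : ℝ × ℝ} {c d : ℝ} (h : HasFDerivAt u (gradCLM c d) q) :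
    dt univ u q = c :=
  dt_eq_of_hasFDerivWithinAt uniqueDiffWithinAt_univ h.hasFDerivWithinAt

theorem dx_univ_eq {u : ℝ × ℝ → ℝ} {q : ℝ × ℝ} {c d : ℝ} (h : HasFDerivAt u (gradCLM c d) q) :
    dx univ u q = d :=
  dx_eq_of_hasFDerivWithinAt uniqueDiffWithinAt_univ h.hasFDerivWithinAt

/-- Derivatives relative to $S$ may be computed from any differentiable extension to the plane. This
is how boundary derivatives are exchanged for ordinary ones below. -/
theorem dt_eq_of_eqOn {S : Set (ℝ × ℝ)} (hS : UniqueDiffOn ℝ S) {u U : ℝ × ℝ → ℝ}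
    (hU : Differentiable ℝ U) (h : EqOn u U S) : EqOn (dt S u) (dt univ U) S := fun q hq =>
  dt_eq_of_hasFDerivWithinAt (hS q hq)
    ((hasFDerivAt_gradCLM (hU q)).hasFDerivWithinAt.congr h (h hq))

theorem dx_eq_of_eqOn {S : Set (ℝ × ℝ)} (hS : UniqueDiffOn ℝ S) {u U : ℝ × ℝ → ℝ}
    (hU : Differentiable ℝ U) (h : EqOn u U S) : EqOn (dx S u) (dx univ U) S := fun q hq =>
  dx_eq_of_hasFDerivWithinAt (hS q hq)
    ((hasFDerivAt_gradCLM (hU q)).hasFDerivWithinAt.congr h (h hq))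

theorem contDiffOn_dt {S : Set (ℝ × ℝ)} (hS : UniqueDiffOn ℝ S) {u : ℝ × ℝ → ℝ}
    (hu : ContDiffOn ℝ 2 u S) : ContDiffOn ℝ 1 (dt S u) S :=
  (hu.fderivWithin hS (m := 1) (by norm_num)).clm_apply contDiffOn_const

theorem contDiffOn_dx {S : Set (ℝ × ℝ)} (hS : UniqueDiffOn ℝ S) {u : ℝ × ℝ → ℝ}
    (hu : ContDiffOn ℝ 2 u S) : ContDiffOn ℝ 1 (dx S u) S :=
  (hu.fderivWithin hS (m := 1) (by norm_num)).clm_apply contDiffOn_const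

theorem contDiff_dt {u : ℝ × ℝ → ℝ} (hu : ContDiff ℝ 2 u) : ContDiff ℝ 1 (dt univ u) :=
  contDiffOn_univ.1 (contDiffOn_dt uniqueDiffOn_univ hu.contDiffOn)

theorem contDiff_dx {u : ℝ × ℝ → ℝ} (hu : ContDiff ℝ 2 u) : ContDiff ℝ 1 (dx univ u) :=
  contDiffOn_univ.1 (contDiffOn_dx uniqueDiffOn_univ hu.contDiffOn)

theorem continuous_dt {u : ℝ × ℝ → ℝ} (hu : ContDiff ℝ 1 u) : Continuous (dt univ u) :=
  continuousOn_univ.1 <|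
    ((hu.contDiffOn (s := univ)).continuousOn_fderivWithin uniqueDiffOn_univ le_rfl).clm_apply
      continuousOn_const

theorem continuousOn_dx {S : Set (ℝ × ℝ)} (hS : UniqueDiffOn ℝ S) {u : ℝ × ℝ → ℝ}
    (hu : ContDiffOn ℝ 1 u S) : ContinuousOn (dx S u) S :=
  (hu.continuousOn_fderivWithin hS le_rfl).clm_apply continuousOn_const

theorem dt_dt_eq_of_eqOn {S : Set (ℝ × ℝ)} (hS : UniqueDiffOn ℝ S) {u U : ℝ × ℝ → ℝ}
    (hU : ContDiff ℝ 2 U) (h : EqOn u U S) :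
    EqOn (dt S (dt S u)) (dt univ (dt univ U)) S :=
  dt_eq_of_eqOn hS ((contDiff_dt hU).differentiable (by norm_num))
    (dt_eq_of_eqOn hS (hU.differentiable (by norm_num)) h)

theorem dx_dx_eq_of_eqOn {S : Set (ℝ × ℝ)} (hS : UniqueDiffOn ℝ S) {u U : ℝ × ℝ → ℝ}
    (hU : ContDiff ℝ 2 U) (h : EqOn u U S) :
    EqOn (dx S (dx S u)) (dx univ (dx univ U)) S :=
  dx_eq_of_eqOn hS ((contDiff_dx hU).differentiable (by norm_num))
    (dx_eq_of_eqOn hS (hU.differentiable (by norm_num)) h)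

theorem contDiff_one_of_hasFDerivAt {U c d : ℝ × ℝ → ℝ}
    (h : ∀ q, HasFDerivAt U (gradCLM (c q) (d q)) q) (hc : Continuous c) (hd : Continuous d) :
    ContDiff ℝ 1 U := by
  refine contDiff_one_iff_hasFDerivAt.2 ⟨_, ?_, h⟩
  simp only [gradCLM]
  fun_prop

theorem contDiff_two_of_hasFDerivAt {U c d : ℝ × ℝ → ℝ}
    (h : ∀ q, HasFDerivAt U (gradCLM (c q) (d q)) q) (hc : ContDiff ℝ 1 c)
    (hd : ContDiff ℝ 1 d) : ContDiff ℝ 2 U := by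
  refine (contDiff_succ_iff_fderiv (n := 1)).2 ⟨fun q => (h q).differentiableAt, by simp, ?_⟩
  rw [show fderiv ℝ U = fun q => gradCLM (c q) (d q) from funext fun q => (h q).fderiv]
  simp only [gradCLM]
  exact (hc.smul contDiff_const).add (hd.smul contDiff_const)

theorem hasFDerivAt_of_partial {U c d : ℝ × ℝ → ℝ}
    (hc : ∀ t x, HasDerivAt (fun s => U (s, x)) (c (t, x)) t)
    (hd : ∀ t x, HasDerivAt (fun s => U (t, s)) (d (t, x)) x)
    (hcc : Continuous c) (hdc : Continuous d) (q : ℝ × ℝ) :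
    HasFDerivAt U (gradCLM (c q) (d q)) q := by
  have := hasStrictFDerivAt_uncurry_coprod (𝕜 := ℝ) (u := q) (f := fun t x => U (t, x))
    (f₁ := fun t x => ContinuousLinearMap.toSpanSingleton ℝ (c (t, x)))
    (f₂ := fun t x => ContinuousLinearMap.toSpanSingleton ℝ (d (t, x)))
    (Eventually.of_forall fun v => (hc v.1 v.2).hasFDerivAt)
    (Eventually.of_forall fun v => (hd v.1 v.2).hasFDerivAt)
    (by
      simp only [Function.HasUncurry.uncurry, id]
      exact ((ContinuousLinearMap.toSpanSingletonCLE (𝕜 := ℝ) (E := ℝ)).continuous.comp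
        hcc).continuousAt)
    (by
      simp only [Function.HasUncurry.uncurry, id]
      exact ((ContinuousLinearMap.toSpanSingletonCLE (𝕜 := ℝ) (E := ℝ)).continuous.comp
        hdc).continuousAt)
  refine this.hasFDerivAt.congr_fderiv ?_
  ext <;> simp [Function.HasUncurry.uncurry]

theorem _root_.HasFDerivWithinAt.hasDerivWithinAt_comp_curve {S : Set (ℝ × ℝ)}
    {U : ℝ × ℝ → ℝ} {A B c d s : ℝ} {x y : ℝ → ℝ} {I : Set ℝ}
    (hU : HasFDerivWithinAt U (gradCLM A B) S (x s, y s))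
    (hx : HasDerivWithinAt x c I s) (hy : HasDerivWithinAt y d I s)
    (hI : MapsTo (fun s => (x s, y s)) I S) :
    HasDerivWithinAt (fun s => U (x s, y s)) (A * c + B * d) I s := by
  exact (HasFDerivWithinAt.comp_hasDerivWithinAt (l := U) s hU (hx.prodMk hy) hI).congr_deriv
    (by simp)

theorem _root_.HasFDerivAt.hasDerivAt_comp_curve {U : ℝ × ℝ → ℝ} {A B c d s : ℝ} {x y : ℝ → ℝ}
    (hU : HasFDerivAt U (gradCLM A B) (x s, y s))
    (hx : HasDerivAt x c s) (hy : HasDerivAt y d s) :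
    HasDerivAt (fun s => U (x s, y s)) (A * c + B * d) s := by
  exact (HasFDerivAt.comp_hasDerivAt (l := U) s hU (hx.prodMk hy)).congr_deriv (by simp)

theorem _root_.HasDerivAt.hasFDerivAt_comp_linear {g : ℝ → ℝ} {g' k : ℝ} {q : ℝ × ℝ}
    (hg : HasDerivAt g g' (q.2 + k * q.1)) :
    HasFDerivAt (fun q : ℝ × ℝ => g (q.2 + k * q.1)) (gradCLM (k * g') g') q := by
  have h1 : HasFDerivAt (fun q : ℝ × ℝ => q.2 + k * q.1) (gradCLM k 1) q := by
    refine ((gradCLM k 1).hasFDerivAt (x := q)).congr_of_eventuallyEq ?_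
    exact Eventually.of_forall fun p => by simp; ring
  refine (HasDerivAt.comp_hasFDerivAt q hg h1).congr_fderiv ?_
  ext <;> simp [mul_comm]

theorem gradCLM_add (c d c' d' : ℝ) :
    gradCLM c d + gradCLM c' d' = gradCLM (c + c') (d + d') := by
  ext <;> simp

theorem gradCLM_sub (c d c' d' : ℝ) :
    gradCLM c d - gradCLM c' d' = gradCLM (c - c') (d - d') := by
  ext <;> simp

/-- The sum of `W` and two travelling waves. -/
def withWaves (a : ℝ) (W : ℝ × ℝ → ℝ) (g p : ℝ → ℝ) (q : ℝ × ℝ) : ℝ :=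
  W q + g (q.2 - a * q.1) + p (q.2 + a * q.1)

theorem hasFDerivAt_withWaves {a : ℝ} {W : ℝ × ℝ → ℝ} {g p : ℝ → ℝ} {q : ℝ × ℝ} {A B g' p' : ℝ}
    (hW : HasFDerivAt W (gradCLM A B) q) (hg : HasDerivAt g g' (q.2 - a * q.1))
    (hp : HasDerivAt p p' (q.2 + a * q.1)) :
    HasFDerivAt (withWaves a W g p) (gradCLM (A - a * g' + a * p') (B + g' + p')) q := by
  have h1 : HasFDerivAt (fun q : ℝ × ℝ => g (q.2 - a * q.1)) (gradCLM (-a * g') g') q := by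
    have : HasDerivAt g g' (q.2 + -a * q.1) := by simpa [← sub_eq_add_neg] using hg
    simpa [← sub_eq_add_neg] using this.hasFDerivAt_comp_linear
  have h2 := (hW.add h1).add hp.hasFDerivAt_comp_linear
  rw [gradCLM_add, gradCLM_add] at h2
  rw [sub_eq_add_neg, ← neg_mul]
  exact h2

section

variable {a : ℝ} {W : ℝ × ℝ → ℝ} {g p : ℝ → ℝ}

theorem contDiff_withWaves (hW : ContDiff ℝ 2 W) (hg : ContDiff ℝ 2 g) (hp : ContDiff ℝ 2 p) :
    ContDiff ℝ 2 (withWaves a W g p) :=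
  (hW.add (hg.comp (contDiff_snd.sub (contDiff_const.mul contDiff_fst)))).add
    (hp.comp (contDiff_snd.add (contDiff_const.mul contDiff_fst)))

theorem dt_withWaves (hW : Differentiable ℝ W) (hg : Differentiable ℝ g)
    (hp : Differentiable ℝ p) :
    dt univ (withWaves a W g p) =
      withWaves a (dt univ W) (fun z => -a * deriv g z) (fun y => a * deriv p y) := by
  funext q
  rw [dt_univ_eq (hasFDerivAt_withWaves (hasFDerivAt_gradCLM (hW q)) (hg _).hasDerivAt
    (hp _).hasDerivAt)]
  simp only [withWaves]; ring

theorem dx_withWaves (hW : Differentiable ℝ W) (hg : Differentiable ℝ g)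
    (hp : Differentiable ℝ p) :
    dx univ (withWaves a W g p) = withWaves a (dx univ W) (deriv g) (deriv p) := by
  funext q
  rw [dx_univ_eq (hasFDerivAt_withWaves (hasFDerivAt_gradCLM (hW q)) (hg _).hasDerivAt
    (hp _).hasDerivAt)]
  rfl

theorem dt_dt_withWaves (hW : ContDiff ℝ 2 W) (hg : ContDiff ℝ 2 g) (hp : ContDiff ℝ 2 p) :
    dt univ (dt univ (withWaves a W g p)) =
      withWaves a (dt univ (dt univ W)) (fun z => a ^ 2 * deriv (deriv g) z)
        (fun y => a ^ 2 * deriv (deriv p) y) := by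
  have h2 : (2 : WithTop ℕ∞) ≠ 0 := by norm_num
  have h1 : (1 : WithTop ℕ∞) ≠ 0 := by norm_num
  rw [dt_withWaves (hW.differentiable h2) (hg.differentiable h2) (hp.differentiable h2),
    dt_withWaves ((contDiff_dt hW).differentiable h1)
      (((contDiff_one_deriv hg).differentiable h1).const_mul _)
      (((contDiff_one_deriv hp).differentiable h1).const_mul _)]
  congr 1 <;> funext z
  · rw [((hasDerivAt_deriv_of_contDiff_two hg z).const_mul (-a)).deriv]; ring
  · rw [((hasDerivAt_deriv_of_contDiff_two hp z).const_mul a).deriv]; ring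

theorem dx_dx_withWaves (hW : ContDiff ℝ 2 W) (hg : ContDiff ℝ 2 g) (hp : ContDiff ℝ 2 p) :
    dx univ (dx univ (withWaves a W g p)) =
      withWaves a (dx univ (dx univ W)) (deriv (deriv g)) (deriv (deriv p)) := by
  have h2 : (2 : WithTop ℕ∞) ≠ 0 := by norm_num
  have h1 : (1 : WithTop ℕ∞) ≠ 0 := by norm_num
  rw [dx_withWaves (hW.differentiable h2) (hg.differentiable h2) (hp.differentiable h2),
    dx_withWaves ((contDiff_dx hW).differentiable h1)
      ((contDiff_one_deriv hg).differentiable h1) ((contDiff_one_deriv hp).differentiable h1)]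

end

end Plane

/-! ### A particular solution with zero Cauchy data. -/

section Duhamel

theorem hasDerivAt_integral_of_continuous_partial {k k₁ : ℝ × ℝ → ℝ} (hk : Continuous k)
    (hk₁ : Continuous k₁) (hd : ∀ τ y, HasDerivAt (fun y => k (τ, y)) (k₁ (τ, y)) y) (t y : ℝ) :
    HasDerivAt (fun y => ∫ τ in (0 : ℝ)..t, k (τ, y)) (∫ τ in (0 : ℝ)..t, k₁ (τ, y)) y := by
  obtain ⟨M, hM⟩ := ((isCompact_uIcc (a := (0 : ℝ)) (b := t)).prod
    (isCompact_closedBall y 1)).exists_bound_of_continuousOn hk₁.continuousOn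
  refine (intervalIntegral.hasDerivAt_integral_of_dominated_loc_of_deriv_le
    (F := fun y τ => k (τ, y)) (F' := fun y τ => k₁ (τ, y)) (bound := fun _ => M)
    (Metric.closedBall_mem_nhds y one_pos) ?_ ?_ ?_ ?_ ?_ ?_).2
  · exact Eventually.of_forall fun y => (by fun_prop : Continuous fun τ => k (τ, y)).aestronglyMeasurable
  · exact (by fun_prop : Continuous fun τ => k (τ, y)).intervalIntegrable _ _
  · exact (by fun_prop : Continuous fun τ => k₁ (τ, y)).aestronglyMeasurable
  · exact Eventually.of_forall fun τ hτ x hx => hM (τ, x) ⟨uIoc_subset_uIcc hτ, hx⟩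
  · exact intervalIntegrable_const
  · exact Eventually.of_forall fun τ _ x _ => hd τ x

theorem continuous_integral_fst {k : ℝ × ℝ → ℝ} (hk : Continuous k) :
    Continuous fun q : ℝ × ℝ => ∫ τ in (0 : ℝ)..q.1, k (τ, q.2) :=
  intervalIntegral.continuous_parametric_intervalIntegral_of_continuous
    (f := fun q τ => k (τ, q.2)) (by fun_prop) continuous_fst

theorem hasFDerivAt_integral_fst {k k₁ : ℝ × ℝ → ℝ} (hk : Continuous k)
    (hk₁ : Continuous k₁) (hd : ∀ τ y, HasDerivAt (fun y => k (τ, y)) (k₁ (τ, y)) y)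
    (q : ℝ × ℝ) :
    HasFDerivAt (fun q : ℝ × ℝ => ∫ τ in (0 : ℝ)..q.1, k (τ, q.2))
      (gradCLM (k q) (∫ τ in (0 : ℝ)..q.1, k₁ (τ, q.2))) q :=
  hasFDerivAt_of_partial (d := fun q : ℝ × ℝ => ∫ τ in (0 : ℝ)..q.1, k₁ (τ, q.2))
    (fun t x => hasDerivAt_integral_of_continuous (by fun_prop : Continuous fun τ => k (τ, x)) 0 t)
    (fun t x => hasDerivAt_integral_of_continuous_partial hk hk₁ hd t x) hk
    (continuous_integral_fst hk₁) q

/-- The integral of `m` along the characteristic of speed `-k` ending at `q`. -/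
noncomputable def charIntegral (k : ℝ) (m : ℝ × ℝ → ℝ) (q : ℝ × ℝ) : ℝ :=
  ∫ τ in (0 : ℝ)..q.1, m (τ, q.2 + k * q.1 - k * τ)

theorem continuous_charIntegral {k : ℝ} {m : ℝ × ℝ → ℝ} (hm : Continuous m) :
    Continuous (charIntegral k m) :=
  (continuous_integral_fst (k := fun p => m (p.1, p.2 - k * p.1)) (by fun_prop)).comp
    (by fun_prop : Continuous fun q : ℝ × ℝ => (q.1, q.2 + k * q.1))

theorem hasFDerivAt_charIntegral {k : ℝ} {m m₁ : ℝ × ℝ → ℝ} (hm : Continuous m)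
    (hm₁ : Continuous m₁) (hd : ∀ τ y, HasDerivAt (fun y => m (τ, y)) (m₁ (τ, y)) y)
    (q : ℝ × ℝ) :
    HasFDerivAt (charIntegral k m)
      (gradCLM (m q + k * charIntegral k m₁ q) (charIntegral k m₁ q)) q := by
  have h1 := hasFDerivAt_integral_fst (k := fun p => m (p.1, p.2 - k * p.1))
    (k₁ := fun p => m₁ (p.1, p.2 - k * p.1)) (by fun_prop) (by fun_prop)
    (fun τ y => (hd τ (y - k * τ)).comp_sub_const y (k * τ)) (q.1, q.2 + k * q.1)
  -- The shear $(t,x)\mapsto(t,x+kt)$ removes $t$ from the integrand, leaving it only in the upper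
  -- limit.
  set P : ℝ × ℝ →L[ℝ] ℝ × ℝ := (ContinuousLinearMap.fst ℝ ℝ ℝ).prod (gradCLM k 1) with hP
  have hPq : ∀ q : ℝ × ℝ, P q = (q.1, q.2 + k * q.1) := fun q => by
    simp [hP, add_comm]
  rw [← hPq] at h1
  have h2 := HasFDerivAt.comp q h1 P.hasFDerivAt
  have h3 : (fun q : ℝ × ℝ => ∫ τ in (0 : ℝ)..q.1, m (τ, q.2 - k * τ)) ∘ P = charIntegral k m := by
    funext p
    simp [hPq, charIntegral]
  rw [h3] at h2
  refine h2.congr_fderiv ?_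
  simp only [hPq]
  ext <;> simp [hP, charIntegral, mul_comm]

/-- Duhamel's double integral, with the inner integration carried out through the $x$-antiderivative
$F$ of $f$. The first derivatives of $W$ are then characteristic integrals of $f$ and the second
ones involve only $f$ and such integrals of $f_1$, so one continuous $x$-derivative of the forcing
is enough for $C^2$. -/
theorem exists_duhamel {a : ℝ} (ha : 0 < a) {f f₁ : ℝ × ℝ → ℝ} (hf : Continuous f)
    (hf₁ : Continuous f₁) (hd : ∀ τ y, HasDerivAt (fun y => f (τ, y)) (f₁ (τ, y)) y) :
    ∃ W : ℝ × ℝ → ℝ, ContDiff ℝ 2 W ∧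
      (∀ q, dt univ (dt univ W) q - a ^ 2 * dx univ (dx univ W) q = f q) ∧
      (∀ x, W (0, x) = 0) ∧ ∀ x, dt univ W (0, x) = 0 := by
  set F : ℝ × ℝ → ℝ := fun q => ∫ ξ in (0 : ℝ)..q.2, f (q.1, ξ) with hF
  have hFc : Continuous F :=
    intervalIntegral.continuous_parametric_intervalIntegral_of_continuous
      (f := fun q ξ => f (q.1, ξ)) (by fun_prop) continuous_snd
  have hFd : ∀ τ y, HasDerivAt (fun y => F (τ, y)) (f (τ, y)) y := fun τ y =>
    hasDerivAt_integral_of_continuous (by fun_prop : Continuous fun ξ => f (τ, ξ)) 0 y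
  set W : ℝ × ℝ → ℝ := fun q => (2 * a)⁻¹ * (charIntegral a F q - charIntegral (-a) F q) with hW
  set Wt : ℝ × ℝ → ℝ := fun q => 2⁻¹ * (charIntegral a f q + charIntegral (-a) f q) with hWt
  set Wx : ℝ × ℝ → ℝ :=
    fun q => (2 * a)⁻¹ * (charIntegral a f q - charIntegral (-a) f q) with hWx
  set D : ℝ × ℝ → ℝ := fun q => charIntegral a f₁ q - charIntegral (-a) f₁ q with hD
  set E : ℝ × ℝ → ℝ := fun q => charIntegral a f₁ q + charIntegral (-a) f₁ q with hE
  have smul_grad : ∀ r c d : ℝ, r • gradCLM c d = gradCLM (r * c) (r * d) := fun r c d => by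
    ext <;> simp
  have h0 : ∀ q, HasFDerivAt W (gradCLM (Wt q) (Wx q)) q := fun q => by
    have := (((hasFDerivAt_charIntegral (k := a) hFc hf hFd q).sub
      (hasFDerivAt_charIntegral (k := -a) hFc hf hFd q)).const_smul (2 * a)⁻¹)
    rw [gradCLM_sub, smul_grad] at this
    refine this.congr_fderiv ?_
    congr 1
    simp only [hWt]; field_simp; ring
  have ht : ∀ q, HasFDerivAt Wt (gradCLM (f q + a / 2 * D q) (2⁻¹ * E q)) q := fun q => by
    have := (((hasFDerivAt_charIntegral (k := a) hf hf₁ hd q).add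
      (hasFDerivAt_charIntegral (k := -a) hf hf₁ hd q)).const_smul (2⁻¹ : ℝ))
    rw [gradCLM_add, smul_grad] at this
    refine this.congr_fderiv ?_
    congr 1
    simp only [hD]; ring
  have hx : ∀ q, HasFDerivAt Wx (gradCLM (2⁻¹ * E q) ((2 * a)⁻¹ * D q)) q := fun q => by
    have := (((hasFDerivAt_charIntegral (k := a) hf hf₁ hd q).sub
      (hasFDerivAt_charIntegral (k := -a) hf hf₁ hd q)).const_smul (2 * a)⁻¹)
    rw [gradCLM_sub, smul_grad] at this
    refine this.congr_fderiv ?_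
    congr 1
    simp only [hE]; field_simp; ring
  have hDc : Continuous D := (continuous_charIntegral hf₁).sub (continuous_charIntegral hf₁)
  have hEc : Continuous E := (continuous_charIntegral hf₁).add (continuous_charIntegral hf₁)
  have hdt : dt univ W = Wt := funext fun q => dt_univ_eq (h0 q)
  have hdx : dx univ W = Wx := funext fun q => dx_univ_eq (h0 q)
  refine ⟨W, contDiff_two_of_hasFDerivAt h0
    (contDiff_one_of_hasFDerivAt ht (hf.add (hDc.const_mul _)) (hEc.const_mul _))
    (contDiff_one_of_hasFDerivAt hx (hEc.const_mul _) (hDc.const_mul _)), fun q => ?_,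
    fun x => by simp [hW, charIntegral], fun x => by simp [hdt, hWt, charIntegral]⟩
  rw [hdt, hdx, dt_univ_eq (ht q), dx_univ_eq (hx q)]
  field_simp
  ring

/-- Duhamel's formula needs no $t$-derivative of the forcing, so no $C^1$ extension is required. The
$x$-derivative is extended by composing with a retraction of the plane onto the strip, then
integrated in $x$ from the wall $x=l$, where $f$ is known for $t\ge0$ and frozen for $t<0$. -/
theorem exists_forcing_extension {a l : ℝ} {Γ : ℝ → ℝ} (h : SlowCurve a l Γ) {f : ℝ × ℝ → ℝ}
    (hf : ContDiffOn ℝ 1 f (strip l Γ)) :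
    ∃ f' f₁ : ℝ × ℝ → ℝ, Continuous f' ∧ Continuous f₁ ∧
      (∀ τ y, HasDerivAt (fun y => f' (τ, y)) (f₁ (τ, y)) y) ∧ EqOn f' f (strip l Γ) := by
  have hΓ := h.continuous
  set ρ : ℝ × ℝ → ℝ × ℝ := fun q => (max q.1 0, max (Γ (max q.1 0)) (min q.2 l)) with hρ
  have hρc : Continuous ρ := by fun_prop
  have hρS : ∀ q, ρ q ∈ strip l Γ := fun q =>
    ⟨le_max_right _ _, le_max_left _ _,
      max_le (h.lt _ (le_max_right _ _)).le (min_le_right _ _)⟩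
  have hρid : ∀ q ∈ strip l Γ, ρ q = q := fun q hq => by
    obtain ⟨h1, h2, h3⟩ := hq
    simp [hρ, max_eq_left h1, min_eq_left h3, max_eq_right h2]
  set f₁ : ℝ × ℝ → ℝ := fun q => dx (strip l Γ) f (ρ q) with hf₁
  have hf₁c : Continuous f₁ :=
    (continuousOn_dx h.uniqueDiffOn_strip hf).comp_continuous hρc hρS
  have hfl : Continuous fun q : ℝ × ℝ => f (max q.1 0, l) :=
    hf.continuousOn.comp_continuous (by fun_prop) fun q => h.mem_strip_right (le_max_right _ _)
  refine ⟨fun q => f (max q.1 0, l) + ∫ ξ in l..q.2, f₁ (q.1, ξ), f₁,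
    hfl.add (intervalIntegral.continuous_parametric_intervalIntegral_of_continuous
      (f := fun (q : ℝ × ℝ) ξ => f₁ (q.1, ξ)) (by fun_prop) continuous_snd), hf₁c,
    fun τ y => (hasDerivAt_integral_of_continuous
      (by fun_prop : Continuous fun ξ => f₁ (τ, ξ)) l y).const_add (f (max τ 0, l)), ?_⟩
  rintro ⟨t, x⟩ ⟨h1, h2, h3⟩
  simp only at h1 h2 h3
  have hu : UniqueDiffOn ℝ (Icc (Γ t) l) := uniqueDiffOn_Icc (h.lt t h1)
  have hmaps : MapsTo (fun s : ℝ => (t, s)) (Icc (Γ t) l) (strip l Γ) :=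
    fun s hs => ⟨h1, hs.1, hs.2⟩
  have hd : ∀ s ∈ Icc (Γ t) l,
      HasDerivWithinAt (fun s => f (t, s)) (f₁ (t, s)) (Icc (Γ t) l) s := fun s hs => by
    have := (hasFDerivWithinAt_gradCLM
      (hf.differentiableOn one_ne_zero _ (hmaps hs))).hasDerivWithinAt_comp_curve
      (x := fun _ => t) (y := fun s => s) (s := s)
      (hasDerivWithinAt_const _ _ t) (hasDerivWithinAt_id _ _) hmaps
    simpa [hf₁, hρid _ (hmaps hs)] using this
  have := eqOn_integral_of_eqOn_derivWithin (convex_Icc _ _) hu (f := fun s => f (t, s))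
    (fun s hs => (hd s hs).differentiableWithinAt)
    (F₁ := fun s => f₁ (t, s)) (by fun_prop)
    (fun s hs => ((hd s hs).derivWithin (hu s hs)).symm) (right_mem_Icc.2 (h.lt t h1).le)
    (show x ∈ Icc (Γ t) l from ⟨h2, h3⟩)
  simpa [max_eq_left h1] using this

/-- A particular solution with zero Cauchy data. -/
theorem exists_particular {a l : ℝ} {Γ : ℝ → ℝ} (h : SlowCurve a l Γ) {f : ℝ × ℝ → ℝ}
    (hf : ContDiffOn ℝ 1 f (strip l Γ)) :
    ∃ W : ℝ × ℝ → ℝ, ContDiff ℝ 2 W ∧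
      (∀ q ∈ strip l Γ, dt univ (dt univ W) q - a ^ 2 * dx univ (dx univ W) q = f q) ∧
      (∀ x, W (0, x) = 0) ∧ ∀ x, dt univ W (0, x) = 0 := by
  obtain ⟨f', f₁, h1, h2, h3, h4⟩ := exists_forcing_extension h hf
  obtain ⟨W, w1, w2, w3, w4⟩ := exists_duhamel h.speed_pos h1 h2 h3
  exact ⟨W, w1, fun q hq => (w2 q).trans (h4 hq), w3, w4⟩

end Duhamel

/-! ### Decomposition of solutions into two travelling waves. -/

section Representation

theorem eq_of_hasDerivAt_zero {F : ℝ → ℝ} {s t : ℝ} (hst : s ≤ t)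
    (hc : ContinuousOn F (Icc s t)) (hd : ∀ x ∈ Ioo s t, HasDerivAt F 0 x) : F s = F t := by
  rcases hst.eq_or_lt with rfl | hlt
  · rfl
  obtain ⟨c, -, hc'⟩ := exists_hasDerivAt_eq_slope F (fun _ => 0) hlt hc hd
  have := sub_pos.2 hlt
  field_simp at hc'
  linarith

theorem eq_of_hasDerivWithinAt_zero {F : ℝ → ℝ} {s t : ℝ} (hst : s ≤ t)
    (hd : ∀ x ∈ Icc s t, HasDerivWithinAt F 0 (Icc s t) x) : F s = F t :=
  eq_of_hasDerivAt_zero hst (fun x hx => (hd x hx).continuousWithinAt) fun x hx =>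
    (hd x (Ioo_subset_Icc_self hx)).hasDerivAt (Icc_mem_nhds hx.1 hx.2)

variable {a l : ℝ} {Γ : ℝ → ℝ}

theorem SlowCurve.strip_mem_nhds (h : SlowCurve a l Γ) {q : ℝ × ℝ} (hq : q ∈ halfStrip l Γ) :
    strip l Γ ∈ 𝓝 q :=
  mem_of_superset ((isOpen_halfStrip h.continuous).mem_nhds hq) halfStrip_subset_strip

theorem dt_dx_eq_dx_dt {S : Set (ℝ × ℝ)} (hu : UniqueDiffOn ℝ S) {v : ℝ × ℝ → ℝ}
    (hv : ContDiffOn ℝ 2 v S) {q : ℝ × ℝ} (hq : q ∈ interior S) :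
    dt S (dx S v) q = dx S (dt S v) q := by
  have hqS := interior_subset hq
  have hsym := (hv q hqS).isSymmSndFDerivWithinAt (by simp) hu (subset_closure hq) hqS
  have hd : DifferentiableWithinAt ℝ (fderivWithin ℝ v S) S q :=
    (hv.fderivWithin hu (m := 1) (by norm_num)).differentiableOn one_ne_zero q hqS
  have key : ∀ e e' : ℝ × ℝ, fderivWithin ℝ (fun p => fderivWithin ℝ v S p e) S q e' =
        fderivWithin ℝ (fderivWithin ℝ v S) S q e' e := fun e e' => by
    rw [fderivWithin_clm_apply (hu q hqS) hd (by fun_prop)]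
    simp [fderivWithin_const_apply]
  change fderivWithin ℝ (fun p => fderivWithin ℝ v S p (0, 1)) S q (1, 0) =
    fderivWithin ℝ (fun p => fderivWithin ℝ v S p (1, 0)) S q (0, 1)
  rw [key, key]
  exact hsym _ _

/-- A function annihilated by `∂ₜ + k ∂ₓ` is constant along the lines `x = y + k t`. -/
theorem SlowCurve.eq_of_transport (h : SlowCurve a l Γ) {α : ℝ × ℝ → ℝ} {k : ℝ}
    (hα : ContDiffOn ℝ 1 α (strip l Γ))
    (hk : ∀ q ∈ halfStrip l Γ, dt (strip l Γ) α q + k * dx (strip l Γ) α q = 0)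
    {s t y : ℝ} (hst : s ≤ t) (hS : ∀ τ ∈ Icc s t, (τ, y + k * τ) ∈ strip l Γ)
    (hQ : ∀ τ ∈ Ioo s t, (τ, y + k * τ) ∈ halfStrip l Γ) :
    α (s, y + k * s) = α (t, y + k * t) := by
  refine eq_of_hasDerivAt_zero (F := fun τ => α (τ, y + k * τ)) hst
    (hα.continuousOn.comp (by fun_prop) hS) fun τ hτ => ?_
  have h1 := (hasFDerivWithinAt_gradCLM (hα.differentiableOn one_ne_zero _
    (halfStrip_subset_strip (hQ τ hτ)))).hasFDerivAt (h.strip_mem_nhds (hQ τ hτ))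
  have h2 : HasDerivAt (fun τ : ℝ => y + k * τ) k τ := by
    simpa using ((hasDerivAt_id τ).const_mul k).const_add y
  refine (h1.hasDerivAt_comp_curve (x := fun τ => τ) (hasDerivAt_id τ) h2).congr_deriv ?_
  rw [← hk _ (hQ τ hτ)]; ring

/-- As the strip need not be convex, the point is joined to $(0,l)$ by a broken line: at fixed time
to the wall $x=l$, then along the wall. -/
theorem SlowCurve.eq_const_of_hasFDerivWithinAt (h : SlowCurve a l Γ) {d : ℝ × ℝ → ℝ}
    (hd : ∀ q ∈ strip l Γ, HasFDerivWithinAt d (gradCLM 0 0) (strip l Γ) q) {q : ℝ × ℝ}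
    (hq : q ∈ strip l Γ) : d q = d (0, l) := by
  obtain ⟨t, x⟩ := q
  obtain ⟨h1, h2, h3⟩ := hq
  simp only at h1 h2 h3
  have e1 : d (t, x) = d (t, l) := by
    have hm : MapsTo (fun s : ℝ => (t, s)) (Icc x l) (strip l Γ) :=
      fun s hs => ⟨h1, h2.trans hs.1, hs.2⟩
    refine eq_of_hasDerivWithinAt_zero (F := fun s => d (t, s)) h3 fun s hs => ?_
    simpa using (hd _ (hm hs)).hasDerivWithinAt_comp_curve (x := fun _ => t) (y := fun s => s)
      (hasDerivWithinAt_const _ _ t) (hasDerivWithinAt_id _ _) hm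
  have e2 : d (0, l) = d (t, l) := by
    have hm : MapsTo (fun s : ℝ => (s, l)) (Icc 0 t) (strip l Γ) :=
      fun s hs => h.mem_strip_right hs.1
    refine eq_of_hasDerivWithinAt_zero (F := fun s => d (s, l)) h1 fun s hs => ?_
    simpa using (hd _ (hm hs)).hasDerivWithinAt_comp_curve (x := fun s => s) (y := fun _ => l)
      (hasDerivWithinAt_id _ _) (hasDerivWithinAt_const _ _ l) hm
  rw [e1, e2]

/-- The invariants $\alpha=v_t+av_x$ and $\beta=v_t-av_x$ are functions of $x+at$ and $x-at$ alone.
Followed forward in time, each characteristic stays in the strip and ends on one lateral boundary,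
so each invariant is read off along one $C^1$ curve, with no case distinction at reflections;
integrating gives $p$ and $g$. -/
theorem SlowCurve.exists_waves_of_homogeneous (h : SlowCurve a l Γ) {v : ℝ × ℝ → ℝ}
    (hv : ContDiffOn ℝ 2 v (strip l Γ))
    (hw : ∀ q ∈ halfStrip l Γ, dt (strip l Γ) (dt (strip l Γ) v) q
      - a ^ 2 * dx (strip l Γ) (dx (strip l Γ) v) q = 0) :
    ∃ g p : ℝ → ℝ, ContDiff ℝ 2 g ∧ ContDiff ℝ 2 p ∧
      EqOn v (withWaves a (fun _ => 0) g p) (strip l Γ) := by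
  have ha := h.speed_pos
  have hu := h.uniqueDiffOn_strip
  set S := strip l Γ with hSdef
  have hvt := contDiffOn_dt hu hv
  have hvx := contDiffOn_dx hu hv
  have hcomb : ∀ k : ℝ, ContDiffOn ℝ 1 (fun q => dt S v q + k * dx S v q) S := fun k =>
    hvt.add (contDiffOn_const.mul hvx)
  have hgrad : ∀ k : ℝ, ∀ q ∈ S,
      dt S (fun q => dt S v q + k * dx S v q) q = dt S (dt S v) q + k * dt S (dx S v) q ∧
      dx S (fun q => dt S v q + k * dx S v q) q = dx S (dt S v) q + k * dx S (dx S v) q := by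
    intro k q hq
    have h1 := (hasFDerivWithinAt_gradCLM (hvt.differentiableOn one_ne_zero q hq)).add
      ((hasFDerivWithinAt_gradCLM (hvx.differentiableOn one_ne_zero q hq)).const_smul k)
    have h2 : k • gradCLM (dt S (dx S v) q) (dx S (dx S v) q) =
        gradCLM (k * dt S (dx S v) q) (k * dx S (dx S v) q) := by ext <;> simp
    rw [h2, gradCLM_add] at h1
    exact ⟨dt_eq_of_hasFDerivWithinAt (hu q hq) h1, dx_eq_of_hasFDerivWithinAt (hu q hq) h1⟩
  set α : ℝ × ℝ → ℝ := fun q => dt S v q + a * dx S v q with hα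
  set β : ℝ × ℝ → ℝ := fun q => dt S v q + -a * dx S v q with hβ
  have hαk : ∀ q ∈ halfStrip l Γ, dt S α q + -a * dx S α q = 0 := fun q hq => by
    obtain ⟨e1, e2⟩ := hgrad a q (halfStrip_subset_strip hq)
    rw [e1, e2, dt_dx_eq_dx_dt hu hv (mem_interior_iff_mem_nhds.2 (h.strip_mem_nhds hq))]
    linarith [hw q hq]
  have hβk : ∀ q ∈ halfStrip l Γ, dt S β q + a * dx S β q = 0 := fun q hq => by
    obtain ⟨e1, e2⟩ := hgrad (-a) q (halfStrip_subset_strip hq)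
    rw [e1, e2, dt_dx_eq_dx_dt hu hv (mem_interior_iff_mem_nhds.2 (h.strip_mem_nhds hq))]
    linarith [hw q hq]
  obtain ⟨Φ, hΦc, hΦm, hΦ, hΦ'⟩ := h.exists_plus_inverse
  have hΦ0 : Φ 0 = 0 := by simpa [h.zero] using hΦ' 0
  have hΦnn : ∀ y, 0 ≤ y → 0 ≤ Φ y := fun y hy => hΦ0 ▸ hΦm.monotone hy
  -- the Riemann invariants, read off on the two lateral boundaries
  have hA : ContDiffOn ℝ 1 (fun y => α (Φ y, Γ (Φ y))) (Ici 0) := by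
    refine (hcomb a).comp (t := S) (f := fun y => (Φ y, Γ (Φ y))) ?_
      (fun y hy => h.mem_strip_left (hΦnn y hy))
    exact ((hΦc.prodMk (h.smooth.comp hΦc)).of_le (by norm_num)).contDiffOn
  have hB : ContDiffOn ℝ 1 (fun z => β ((l - z) / a, l)) (Iic l) := by
    refine (hcomb (-a)).comp (t := S) (f := fun z => ((l - z) / a, l)) ?_
      (fun z hz => h.mem_strip_right (div_nonneg (sub_nonneg.2 hz) ha.le))
    exact (((contDiff_const.sub contDiff_id).div_const a).prodMk contDiff_const).contDiffOn
  obtain ⟨A, hAc, hAe⟩ := exists_contDiff_one_extension (convex_Ici 0) (uniqueDiffOn_Ici 0)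
    isClosed_Ici nonempty_Ici hA
  obtain ⟨B, hBc, hBe⟩ := exists_contDiff_one_extension (convex_Iic l) (uniqueDiffOn_Iic l)
    isClosed_Iic nonempty_Iic hB
  -- The characteristic moves left until time $\Phi(x+at)$. It stays below $l$ since it moves left,
  -- and above the curve since $\gamma_+$ increases.
  have hαA : ∀ q ∈ S, α q = A (q.2 + a * q.1) := by
    intro q hq
    have hy := h.add_nonneg_of_mem_strip hq
    obtain ⟨t, x⟩ := q
    obtain ⟨h1, h2, h3⟩ := hq
    simp only at h1 h2 h3 hy ⊢
    rw [hAe (mem_Ici.2 hy)]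
    have hle : t ≤ Φ (x + a * t) := by
      refine h.strictMono_plus.le_iff_le.1 ?_
      rw [hΦ]; linarith
    have hup : ∀ τ, τ ≤ Φ (x + a * t) → Γ τ ≤ x + a * t + -a * τ := fun τ hτ => by
      have := h.strictMono_plus.monotone hτ
      beta_reduce at this
      rw [hΦ] at this; linarith
    have hup' : ∀ τ, τ < Φ (x + a * t) → Γ τ < x + a * t + -a * τ := fun τ hτ => by
      have := h.strictMono_plus hτ
      beta_reduce at this
      rw [hΦ] at this; linarith
    have := h.eq_of_transport (hcomb a) hαk (s := t) (t := Φ (x + a * t)) (y := x + a * t) hle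
      (fun τ hτ => ⟨h1.trans hτ.1, hup τ hτ.2, by simp only; nlinarith [hτ.1]⟩)
      (fun τ hτ => ⟨h1.trans_lt hτ.1, hup' τ hτ.2, by simp only; nlinarith [hτ.1]⟩)
    have e1 : x + a * t + -a * t = x := by ring
    have e2 : x + a * t + -a * Φ (x + a * t) = Γ (Φ (x + a * t)) := by
      linarith [hΦ (x + a * t)]
    rw [e1, e2] at this
    exact this
  -- This characteristic moves right until it reaches $x=l$; it stays above the curve since
  -- $\gamma_-$ decreases.
  have hβB : ∀ q ∈ S, β q = B (q.2 - a * q.1) := by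
    intro q hq
    have hz := h.sub_le_of_mem_strip hq
    obtain ⟨t, x⟩ := q
    obtain ⟨h1, h2, h3⟩ := hq
    simp only at h1 h2 h3 hz ⊢
    rw [hBe (mem_Iic.2 hz)]
    have hend : a * ((l - (x - a * t)) / a) = l - (x - a * t) := by field_simp
    have hle : t ≤ (l - (x - a * t)) / a := by rw [le_div_iff₀ ha]; linarith
    have hlo : ∀ τ, t ≤ τ → Γ τ ≤ x - a * t + a * τ := fun τ hτ => by
      have := h.strictAnti_minus.antitone hτ
      beta_reduce at this
      linarith
    have hlo' : ∀ τ, t < τ → Γ τ < x - a * t + a * τ := fun τ hτ => by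
      have := h.strictAnti_minus hτ
      beta_reduce at this
      linarith
    have := h.eq_of_transport (hcomb (-a)) hβk (s := t) (t := (l - (x - a * t)) / a)
      (y := x - a * t) hle
      (fun τ hτ => ⟨h1.trans hτ.1, hlo τ hτ.1, by
        have := (le_div_iff₀ ha).1 hτ.2
        simp only; linarith⟩)
      (fun τ hτ => ⟨h1.trans_lt hτ.1, hlo' τ hτ.1, by
        have := (lt_div_iff₀ ha).1 hτ.2
        simp only; linarith⟩)
    have e1 : x - a * t + a * t = x := by ring
    rw [e1, hend, add_sub_cancel] at this
    exact this
  -- For $v=g(x-at)+p(x+at)$ one has $\alpha=2ap'$ and $\beta=-2ag'$, which dictates the two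
  -- factors.
  set p : ℝ → ℝ := fun y => (2 * a)⁻¹ * ∫ ξ in (0 : ℝ)..y, A ξ with hp
  set g : ℝ → ℝ := fun z => -(2 * a)⁻¹ * ∫ ξ in (0 : ℝ)..z, B ξ with hg
  have hpd : ∀ y, HasDerivAt p ((2 * a)⁻¹ * A y) y := fun y =>
    (hasDerivAt_integral_of_continuous hAc.continuous 0 y).const_mul _
  have hgd : ∀ z, HasDerivAt g (-(2 * a)⁻¹ * B z) z := fun z =>
    (hasDerivAt_integral_of_continuous hBc.continuous 0 z).const_mul _
  have hpc : ContDiff ℝ 2 p := contDiff_two_of_hasDerivAt hpd (contDiff_const.mul hAc)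
  have hgc : ContDiff ℝ 2 g := contDiff_two_of_hasDerivAt hgd (contDiff_const.mul hBc)
  set U : ℝ × ℝ → ℝ := withWaves a (fun _ => 0) g p with hU
  have hd : ∀ q ∈ S, HasFDerivWithinAt (fun q => v q - U q) (gradCLM 0 0) S q := fun q hq => by
    have h0 : HasFDerivAt (fun _ : ℝ × ℝ => (0 : ℝ)) (gradCLM 0 0) q := by
      refine (hasFDerivAt_const (0 : ℝ) q).congr_fderiv ?_
      ext <;> simp
    have h1 := (hasFDerivWithinAt_gradCLM (hv.differentiableOn two_ne_zero q hq)).sub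
      (hasFDerivAt_withWaves (a := a) h0 (hgd _) (hpd _)).hasFDerivWithinAt
    rw [gradCLM_sub] at h1
    refine h1.congr_fderiv ?_
    have e1 := hαA q hq
    have e2 := hβB q hq
    simp only [hα, hβ] at e1 e2
    rw [← e1, ← e2]
    congr 1 <;> field_simp <;> ring
  -- Both first derivatives of $v$ and $U$ agree, so they differ by a constant, which is absorbed in
  -- $g$.
  refine ⟨fun z => g z + (v (0, l) - U (0, l)), p, hgc.add contDiff_const, hpc, fun q hq => ?_⟩
  have := h.eq_const_of_hasFDerivWithinAt hd hq
  have e : withWaves a (fun _ => 0) (fun z => g z + (v (0, l) - U (0, l))) p q =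
      U q + (v (0, l) - U (0, l)) := by
    simp only [hU, withWaves]; ring
  rw [e]
  linarith

theorem SlowCurve.exists_waves (h : SlowCurve a l Γ) {φ ψ : ℝ → ℝ} {f u W : ℝ × ℝ → ℝ}
    (hW : ContDiff ℝ 2 W)
    (hWf : ∀ q ∈ strip l Γ, dt univ (dt univ W) q - a ^ 2 * dx univ (dx univ W) q = f q)
    (hu : SolvesCauchy a l Γ φ ψ f u) :
    ∃ g p : ℝ → ℝ, ContDiff ℝ 2 g ∧ ContDiff ℝ 2 p ∧ EqOn u (withWaves a W g p) (strip l Γ) := by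
  obtain ⟨h1, h2, -, -⟩ := hu
  rw [h.closure_halfStrip] at h1 h2
  have hd := h.uniqueDiffOn_strip
  set S := strip l Γ with hS
  have key : ∀ {e : ℝ × ℝ} {u₁ u₂ : ℝ × ℝ → ℝ}, DifferentiableOn ℝ u₁ S → DifferentiableOn ℝ u₂ S →
      ∀ q ∈ S, fderivWithin ℝ (fun q => u₁ q - u₂ q) S q e =
        fderivWithin ℝ u₁ S q e - fderivWithin ℝ u₂ S q e := fun hu₁ hu₂ q hq => by
    rw [fderivWithin_fun_sub (hd q hq) (hu₁ q hq) (hu₂ q hq)]; rfl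
  have hWS := hW.contDiffOn (s := S)
  have hW1 := hW.differentiable two_ne_zero
  have one : (1 : WithTop ℕ∞) ≠ 0 := one_ne_zero
  obtain ⟨g, p, hg, hp, hgp⟩ := h.exists_waves_of_homogeneous (v := fun q => u q - W q)
    (h1.sub hWS) fun q hq => by
      have hqS := halfStrip_subset_strip hq
      have e1 : dt S (dt S fun q => u q - W q) q = dt S (dt S u) q - dt S (dt S W) q := by
        have hE : EqOn (dt S fun q => u q - W q) (fun q => dt S u q - dt S W q) S :=
          key (h1.differentiableOn two_ne_zero) hW1.differentiableOn
        exact (congrArg (fun A : ℝ × ℝ →L[ℝ] ℝ => A (1, 0)) (fderivWithin_congr hE (hE hqS))).trans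
          (key ((contDiffOn_dt hd h1).differentiableOn one)
            ((contDiffOn_dt hd hWS).differentiableOn one) q hqS)
      have e2 : dx S (dx S fun q => u q - W q) q = dx S (dx S u) q - dx S (dx S W) q := by
        have hE : EqOn (dx S fun q => u q - W q) (fun q => dx S u q - dx S W q) S :=
          key (h1.differentiableOn two_ne_zero) hW1.differentiableOn
        exact (congrArg (fun A : ℝ × ℝ →L[ℝ] ℝ => A (0, 1)) (fderivWithin_congr hE (hE hqS))).trans
          (key ((contDiffOn_dx hd h1).differentiableOn one)
            ((contDiffOn_dx hd hWS).differentiableOn one) q hqS)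
      rw [e1, e2, dt_dt_eq_of_eqOn hd hW (fun _ _ => rfl) hqS,
        dx_dx_eq_of_eqOn hd hW (fun _ _ => rfl) hqS]
      linarith [h2 q hq, hWf q hqS]
  refine ⟨g, p, hg, hp, fun q hq => ?_⟩
  have := hgp hq
  simp only [withWaves] at this ⊢
  linarith

end Representation

/-! ### The mixed problem in terms of the profiles; the matching conditions. -/

section System

variable {a b l : ℝ} {Γ φ ψ μ₁ μ₂ g p : ℝ → ℝ} {f u W : ℝ × ℝ → ℝ}

/-- The mixed problem rewritten for the profiles `g` and `p` of the two travelling waves. -/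
structure WaveSystem (a b l : ℝ) (Γ φ ψ μ₁ μ₂ : ℝ → ℝ) (W : ℝ × ℝ → ℝ) (g p : ℝ → ℝ) : Prop where
  initial : ∀ x ∈ Icc 0 l, g x + p x = φ x
  initial_dt : ∀ x ∈ Icc 0 l, a * (deriv p x - deriv g x) = ψ x
  left : ∀ t, 0 ≤ t → W (t, Γ t) + g (Γ t - a * t) + p (Γ t + a * t) = μ₁ t
  right : ∀ t, 0 ≤ t → dt univ (dt univ W) (t, l) + b * dx univ W (t, l)
    + a ^ 2 * (deriv (deriv g) (l - a * t) + deriv (deriv p) (l + a * t))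
    + b * (deriv g (l - a * t) + deriv p (l + a * t)) = μ₂ t

theorem SolvesCauchy.profiles (h : SlowCurve a l Γ) (hW : ContDiff ℝ 2 W)
    (hW0 : ∀ x ∈ Icc 0 l, W (0, x) = 0) (hWt0 : ∀ x ∈ Icc 0 l, dt univ W (0, x) = 0)
    (hg : ContDiff ℝ 2 g) (hp : ContDiff ℝ 2 p) (hu : EqOn u (withWaves a W g p) (strip l Γ))
    (hs : SolvesCauchy a l Γ φ ψ f u) :
    (∀ x ∈ Icc 0 l, g x + p x = φ x) ∧ ∀ x ∈ Icc 0 l, a * (deriv p x - deriv g x) = ψ x := by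
  refine ⟨fun x hx => ?_, fun x hx => ?_⟩
  · have h1 := hs.initial x hx
    rw [hu (h.mem_strip_initial hx)] at h1
    simpa [withWaves, hW0 x hx] using h1
  · have h1 := hs.initial_dt x hx
    rw [h.closure_halfStrip, dt_eq_of_eqOn h.uniqueDiffOn_strip
      ((contDiff_withWaves hW hg hp).differentiable two_ne_zero) hu (h.mem_strip_initial hx),
      dt_withWaves (hW.differentiable two_ne_zero) (hg.differentiable two_ne_zero)
        (hp.differentiable two_ne_zero)] at h1
    simp only [withWaves, hWt0 x hx, mul_zero, sub_zero, add_zero] at h1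
    rw [← h1]; ring

theorem SolvesMixed.waveSystem (h : SlowCurve a l Γ) (hW : ContDiff ℝ 2 W)
    (hW0 : ∀ x ∈ Icc 0 l, W (0, x) = 0) (hWt0 : ∀ x ∈ Icc 0 l, dt univ W (0, x) = 0)
    (hg : ContDiff ℝ 2 g) (hp : ContDiff ℝ 2 p) (hu : EqOn u (withWaves a W g p) (strip l Γ))
    (hs : SolvesMixed a b l Γ φ ψ μ₁ μ₂ f u) : WaveSystem a b l Γ φ ψ μ₁ μ₂ W g p := by
  obtain ⟨h1, h2⟩ := hs.toSolvesCauchy.profiles h hW hW0 hWt0 hg hp hu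
  refine ⟨h1, h2, fun t ht => ?_, fun t ht => ?_⟩
  · rw [← hs.boundary_left t ht, hu (h.mem_strip_left ht)]; rfl
  · have h3 := hs.boundary_right t ht
    have hU := contDiff_withWaves (a := a) hW hg hp
    rw [h.closure_halfStrip, dx_eq_of_eqOn h.uniqueDiffOn_strip (hU.differentiable two_ne_zero) hu
      (h.mem_strip_right ht), dt_dt_eq_of_eqOn h.uniqueDiffOn_strip hU hu (h.mem_strip_right ht),
      dt_dt_withWaves hW hg hp, dx_withWaves (hW.differentiable two_ne_zero)
        (hg.differentiable two_ne_zero) (hp.differentiable two_ne_zero)] at h3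
    simp only [withWaves] at h3
    rw [← h3]; ring

theorem WaveSystem.solvesMixed (h : SlowCurve a l Γ) (hW : ContDiff ℝ 2 W)
    (hWf : ∀ q ∈ strip l Γ, dt univ (dt univ W) q - a ^ 2 * dx univ (dx univ W) q = f q)
    (hW0 : ∀ x, W (0, x) = 0) (hWt0 : ∀ x, dt univ W (0, x) = 0)
    (hg : ContDiff ℝ 2 g) (hp : ContDiff ℝ 2 p) (hs : WaveSystem a b l Γ φ ψ μ₁ μ₂ W g p) :
    SolvesMixed a b l Γ φ ψ μ₁ μ₂ f (withWaves a W g p) := by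
  have hU := contDiff_withWaves (a := a) hW hg hp
  have hW1 := hW.differentiable two_ne_zero
  have hg1 := hg.differentiable two_ne_zero
  have hp1 := hp.differentiable two_ne_zero
  have hud := h.uniqueDiffOn_strip
  have hrefl : EqOn (withWaves a W g p) (withWaves a W g p) (strip l Γ) := fun _ _ => rfl
  refine ⟨⟨hU.contDiffOn, fun q hq => ?_, fun x hx => ?_, fun x hx => ?_⟩, fun t ht => ?_,
    fun t ht => ?_⟩
  · have hqS := halfStrip_subset_strip hq
    rw [h.closure_halfStrip, dt_dt_eq_of_eqOn hud hU hrefl hqS, dx_dx_eq_of_eqOn hud hU hrefl hqS,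
      dt_dt_withWaves hW hg hp, dx_dx_withWaves hW hg hp, ← hWf q hqS]
    simp only [withWaves]; ring
  · simpa [withWaves, hW0 x] using hs.initial x hx
  · rw [h.closure_halfStrip, dt_eq_of_eqOn hud (hU.differentiable two_ne_zero) hrefl
      (h.mem_strip_initial hx), dt_withWaves hW1 hg1 hp1, ← hs.initial_dt x hx]
    simp only [withWaves, hWt0 x, mul_zero, sub_zero, add_zero]; ring
  · exact hs.left t ht
  · rw [h.closure_halfStrip, dx_eq_of_eqOn hud (hU.differentiable two_ne_zero) hrefl
      (h.mem_strip_right ht), dt_dt_eq_of_eqOn hud hU hrefl (h.mem_strip_right ht),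
      dt_dt_withWaves hW hg hp, dx_withWaves hW1 hg1 hp1, ← hs.right t ht]
    simp only [withWaves]; ring

theorem dx_initial_eq_zero {V : ℝ × ℝ → ℝ} (hV : Differentiable ℝ V) (h0 : ∀ x, V (0, x) = 0)
    (x : ℝ) : dx univ V (0, x) = 0 := by
  have h1 := (hasFDerivAt_gradCLM (hV (0, x))).hasDerivAt_comp_curve
    (x := fun _ => (0 : ℝ)) (y := fun s => s) (s := x) (hasDerivAt_const _ _) (hasDerivAt_id x)
  simp only [h0, mul_zero, zero_add, mul_one] at h1
  exact h1.unique (hasDerivAt_const x (0 : ℝ))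

/-- The defect of the boundary condition on the moving boundary. -/
def leftDefect (a : ℝ) (Γ M : ℝ → ℝ) (W : ℝ × ℝ → ℝ) (g p : ℝ → ℝ) (t : ℝ) : ℝ :=
  M t - W (t, Γ t) - g (Γ t - a * t) - p (Γ t + a * t)

/-- The derivative of `leftDefect`. -/
noncomputable def leftDefectDeriv (a : ℝ) (Γ M : ℝ → ℝ) (W : ℝ × ℝ → ℝ) (g p : ℝ → ℝ) (t : ℝ) : ℝ :=
  deriv M t - (dt univ W (t, Γ t) + dx univ W (t, Γ t) * deriv Γ t)
    - deriv g (Γ t - a * t) * (deriv Γ t - a) - deriv p (Γ t + a * t) * (deriv Γ t + a)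

section LeftDefect

variable {M : ℝ → ℝ}

theorem contDiff_leftDefect (h : SlowCurve a l Γ) (hM : ContDiff ℝ 2 M) (hW : ContDiff ℝ 2 W)
    (hg : ContDiff ℝ 2 g) (hp : ContDiff ℝ 2 p) : ContDiff ℝ 2 (leftDefect a Γ M W g p) := by
  have hΓ := h.smooth
  unfold leftDefect
  fun_prop

theorem hasDerivAt_leftDefect (h : SlowCurve a l Γ) (hM : ContDiff ℝ 2 M) (hW : ContDiff ℝ 2 W)
    (hg : ContDiff ℝ 2 g) (hp : ContDiff ℝ 2 p) (t : ℝ) :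
    HasDerivAt (leftDefect a Γ M W g p) (leftDefectDeriv a Γ M W g p t) t := by
  have h1 := (hasFDerivAt_gradCLM (hW.differentiable two_ne_zero (t, Γ t))).hasDerivAt_comp_curve
    (x := fun t => t) (hasDerivAt_id t) (h.hasDerivAt t)
  have h2 := (hasDerivAt_of_contDiff_two hg (Γ t - a * t)).comp t (h.hasDerivAt_minus t)
  have h3 := (hasDerivAt_of_contDiff_two hp (Γ t + a * t)).comp t (h.hasDerivAt_plus t)
  refine ((((hasDerivAt_of_contDiff_two hM t).sub h1).sub h2).sub h3).congr_deriv ?_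
  simp only [leftDefectDeriv, mul_one]

theorem deriv_leftDefect_zero (h : SlowCurve a l Γ) (hM : ContDiff ℝ 2 M) (hW : ContDiff ℝ 2 W)
    (hW0 : ∀ x, W (0, x) = 0) (hWt0 : ∀ x, dt univ W (0, x) = 0)
    (hg : ContDiff ℝ 2 g) (hp : ContDiff ℝ 2 p) :
    deriv (leftDefect a Γ M W g p) 0 =
      deriv M 0 - deriv g 0 * (deriv Γ 0 - a) - deriv p 0 * (deriv Γ 0 + a) := by
  rw [(hasDerivAt_leftDefect h hM hW hg hp 0).deriv]
  simp [leftDefectDeriv, h.zero, hWt0, dx_initial_eq_zero (hW.differentiable two_ne_zero) hW0]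

/-- At the corner the zero Cauchy data annihilate every derivative of $W$ up to second order except
$W_{tt}$, which the equation makes equal to $f(0,0)$. The rest is the chain rule along the curve. -/
theorem deriv_deriv_leftDefect_zero (h : SlowCurve a l Γ) (hM : ContDiff ℝ 2 M)
    (hW : ContDiff ℝ 2 W)
    (hWf : ∀ q ∈ strip l Γ, dt univ (dt univ W) q - a ^ 2 * dx univ (dx univ W) q = f q)
    (hW0 : ∀ x, W (0, x) = 0) (hWt0 : ∀ x, dt univ W (0, x) = 0)
    (hg : ContDiff ℝ 2 g) (hp : ContDiff ℝ 2 p) :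
    deriv (deriv (leftDefect a Γ M W g p)) 0 =
      deriv (deriv M) 0 - f (0, 0)
        - (deriv (deriv g) 0 * (deriv Γ 0 - a) ^ 2 + deriv g 0 * deriv (deriv Γ) 0)
        - (deriv (deriv p) 0 * (deriv Γ 0 + a) ^ 2 + deriv p 0 * deriv (deriv Γ) 0) := by
  have hE : deriv (leftDefect a Γ M W g p) = leftDefectDeriv a Γ M W g p :=
    funext fun t => (hasDerivAt_leftDefect h hM hW hg hp t).deriv
  have hW1 := hW.differentiable two_ne_zero
  have hdt := (contDiff_dt hW).differentiable one_ne_zero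
  have hdx := (contDiff_dx hW).differentiable one_ne_zero
  have hx := dx_initial_eq_zero hW1 hW0
  have hxx := dx_initial_eq_zero hdx hx
  have htx := dx_initial_eq_zero hdt hWt0
  have hxt : dt univ (dx univ W) (0, 0) = 0 := by
    rw [dt_dx_eq_dx_dt uniqueDiffOn_univ hW.contDiffOn (by simp), htx]
  have htt : dt univ (dt univ W) (0, 0) = f (0, 0) := by
    have := hWf (0, 0) (h.mem_strip_initial ⟨le_rfl, h.length_pos.le⟩)
    rw [hxx] at this; linarith
  have hΓ' := hasDerivAt_deriv_of_contDiff_two h.smooth 0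
  have h1 := (hasFDerivAt_gradCLM (hdt (0, Γ 0))).hasDerivAt_comp_curve
    (x := fun t => t) (s := 0) (hasDerivAt_id 0) (h.hasDerivAt 0)
  have h2 := ((hasFDerivAt_gradCLM (hdx (0, Γ 0))).hasDerivAt_comp_curve
    (x := fun t => t) (s := 0) (hasDerivAt_id 0) (h.hasDerivAt 0)).mul hΓ'
  have h3 := ((hasDerivAt_deriv_of_contDiff_two hg (Γ 0 - a * 0)).comp 0
    (h.hasDerivAt_minus 0)).mul (hΓ'.sub_const a)
  have h4 := ((hasDerivAt_deriv_of_contDiff_two hp (Γ 0 + a * 0)).comp 0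
    (h.hasDerivAt_plus 0)).mul (hΓ'.add_const a)
  have h5 := (((hasDerivAt_deriv_of_contDiff_two hM 0).sub (h1.add h2)).sub h3).sub h4
  rw [hE]
  refine Eq.trans (HasDerivAt.deriv h5) ?_
  simp only [Function.comp, h.zero, mul_zero, sub_zero, add_zero, hx, hxx, htx, hxt, htt, mul_one]
  ring

/-- The matching conditions say that `leftDefect` vanishes to second order at the left corner and
that the right boundary condition holds at the right corner. -/
theorem matching_iff (h : SlowCurve a l Γ) (hM : ContDiff ℝ 2 M) (hMμ : EqOn μ₁ M (Ici 0))
    (hW : ContDiff ℝ 2 W)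
    (hWf : ∀ q ∈ strip l Γ, dt univ (dt univ W) q - a ^ 2 * dx univ (dx univ W) q = f q)
    (hW0 : ∀ x, W (0, x) = 0) (hWt0 : ∀ x, dt univ W (0, x) = 0)
    (hg : ContDiff ℝ 2 g) (hp : ContDiff ℝ 2 p)
    (hφ : ∀ x ∈ Icc 0 l, g x + p x = φ x)
    (hψ : ∀ x ∈ Icc 0 l, a * (deriv p x - deriv g x) = ψ x) :
    Matching a b l Γ φ ψ μ₁ μ₂ f ↔
      leftDefect a Γ M W g p 0 = 0 ∧ deriv (leftDefect a Γ M W g p) 0 = 0 ∧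
      deriv (deriv (leftDefect a Γ M W g p)) 0 = 0 ∧
      μ₂ 0 - f (0, l) - b * (deriv g l + deriv p l)
        - a ^ 2 * (deriv (deriv g) l + deriv (deriv p) l) = 0 := by
  have hl := h.length_pos
  have hI := uniqueDiffOn_Icc hl
  have hJ := uniqueDiffOn_Ici (0 : ℝ)
  have m0 : (0 : ℝ) ∈ Icc 0 l := ⟨le_rfl, hl.le⟩
  have ml : l ∈ Icc 0 l := ⟨hl.le, le_rfl⟩
  have j0 : (0 : ℝ) ∈ Ici (0 : ℝ) := self_mem_Ici
  have hφ' : EqOn φ (fun x => g x + p x) (Icc 0 l) := fun x hx => (hφ x hx).symm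
  have hψ' : EqOn ψ (fun x => a * (deriv p x - deriv g x)) (Icc 0 l) := fun x hx => (hψ x hx).symm
  have hgp : ContDiff ℝ 2 fun x => g x + p x := hg.add hp
  have d1 : deriv (fun x => g x + p x) = fun x => deriv g x + deriv p x := funext fun x =>
    ((hasDerivAt_of_contDiff_two hg x).add (hasDerivAt_of_contDiff_two hp x)).deriv
  have d2 : deriv (deriv fun x => g x + p x) = fun x => deriv (deriv g) x + deriv (deriv p) x := by
    rw [d1]
    exact funext fun x => ((hasDerivAt_deriv_of_contDiff_two hg x).add
      (hasDerivAt_deriv_of_contDiff_two hp x)).deriv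
  have d3 : ∀ x, HasDerivAt (fun x => a * (deriv p x - deriv g x))
      (a * (deriv (deriv p) x - deriv (deriv g) x)) x := fun x =>
    ((hasDerivAt_deriv_of_contDiff_two hp x).sub (hasDerivAt_deriv_of_contDiff_two hg x)).const_mul a
  have e1 : ∀ x ∈ Icc 0 l, derivWithin φ (Icc 0 l) x = deriv g x + deriv p x := fun x hx => by
    rw [derivWithin_eq_deriv_of_eqOn hI (hgp.differentiable two_ne_zero) hφ' hx, d1]
  have e2 : ∀ x ∈ Icc 0 l, iteratedDerivWithin 2 φ (Icc 0 l) x =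
      deriv (deriv g) x + deriv (deriv p) x := fun x hx => by
    rw [iteratedDerivWithin_two_eq_of_eqOn hI hgp hφ' hx, d2]
  have e3 : derivWithin ψ (Icc 0 l) 0 = a * (deriv (deriv p) 0 - deriv (deriv g) 0) := by
    rw [derivWithin_eq_deriv_of_eqOn hI (fun x => (d3 x).differentiableAt) hψ' m0, (d3 0).deriv]
  have e4 : derivWithin Γ (Ici 0) 0 = deriv Γ 0 :=
    derivWithin_eq_deriv_of_eqOn hJ (h.smooth.differentiable two_ne_zero) (fun _ _ => rfl) j0
  have e5 : iteratedDerivWithin 2 Γ (Ici 0) 0 = deriv (deriv Γ) 0 :=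
    iteratedDerivWithin_two_eq_of_eqOn hJ h.smooth (fun _ _ => rfl) j0
  have e6 : derivWithin μ₁ (Ici 0) 0 = deriv M 0 :=
    derivWithin_eq_deriv_of_eqOn hJ (hM.differentiable two_ne_zero) hMμ j0
  have e7 : iteratedDerivWithin 2 μ₁ (Ici 0) 0 = deriv (deriv M) 0 :=
    iteratedDerivWithin_two_eq_of_eqOn hJ hM hMμ j0
  have z0 : leftDefect a Γ M W g p 0 = μ₁ 0 - φ 0 := by
    simp only [leftDefect, h.zero, hW0, hMμ j0, ← hφ 0 m0, mul_zero, sub_zero, add_zero]; ring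
  -- With $\varphi=g+p$ and $\psi=a(p'-g')$: $g'(\Gamma'-a)+p'(\Gamma'+a)=\Gamma'\varphi'+\psi$.
  have z1 : deriv (leftDefect a Γ M W g p) 0 = derivWithin μ₁ (Ici 0) 0 - ψ 0
      - derivWithin Γ (Ici 0) 0 * derivWithin φ (Icc 0 l) 0 := by
    rw [deriv_leftDefect_zero h hM hW hW0 hWt0 hg hp, e6, e4, e1 0 m0, ← hψ 0 m0]; ring
  -- Here $g''(\Gamma'-a)^2+p''(\Gamma'+a)^2=(a^2+\Gamma'^2)\varphi''+2\Gamma'\psi'$.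
  have z2 : deriv (deriv (leftDefect a Γ M W g p)) 0 = iteratedDerivWithin 2 μ₁ (Ici 0) 0
      - (a ^ 2 + derivWithin Γ (Ici 0) 0 ^ 2) * iteratedDerivWithin 2 φ (Icc 0 l) 0
      - f (0, 0)
      - 2 * derivWithin Γ (Ici 0) 0 * derivWithin ψ (Icc 0 l) 0
      - iteratedDerivWithin 2 Γ (Ici 0) 0 * derivWithin φ (Icc 0 l) 0 := by
    rw [deriv_deriv_leftDefect_zero h hM hW hWf hW0 hWt0 hg hp, e7, e4, e2 0 m0, e3, e5, e1 0 m0]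
    ring
  rw [z0, z1, z2, ← e1 l ml, ← e2 l ml]
  exact ⟨fun m => ⟨m.1, m.2, m.3, m.4⟩, fun m => ⟨m.1, m.2.1, m.2.2.1, m.2.2.2⟩⟩

/-- For a solution the left error is zero on $[0,\infty)$, which forces its derivatives at the end
point $0$ to vanish; the last condition is the right boundary condition at $t=0$, where $W_{tt}=f$
and $W_x=0$. -/
theorem WaveSystem.matching (h : SlowCurve a l Γ) (hM : ContDiff ℝ 2 M)
    (hMμ : EqOn μ₁ M (Ici 0)) (hW : ContDiff ℝ 2 W)
    (hWf : ∀ q ∈ strip l Γ, dt univ (dt univ W) q - a ^ 2 * dx univ (dx univ W) q = f q)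
    (hW0 : ∀ x, W (0, x) = 0) (hWt0 : ∀ x, dt univ W (0, x) = 0)
    (hg : ContDiff ℝ 2 g) (hp : ContDiff ℝ 2 p) (hs : WaveSystem a b l Γ φ ψ μ₁ μ₂ W g p) :
    Matching a b l Γ φ ψ μ₁ μ₂ f := by
  rw [matching_iff h hM hMμ hW hWf hW0 hWt0 hg hp hs.initial hs.initial_dt]
  have hE : EqOn (leftDefect a Γ M W g p) (fun _ => 0) (Ici 0) := fun t ht => by
    simp only [leftDefect, ← hMμ ht, ← hs.left t ht]; ring
  have hEc := contDiff_leftDefect h hM hW hg hp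
  have hJ := uniqueDiffOn_Ici (0 : ℝ)
  have hc : ContDiff ℝ 2 fun _ : ℝ => (0 : ℝ) := contDiff_const
  refine ⟨hE self_mem_Ici, ?_, ?_, ?_⟩
  · rw [eqOn_deriv_of_eqOn hJ (hEc.differentiable two_ne_zero) (hc.differentiable two_ne_zero) hE
      self_mem_Ici]
    simp
  · rw [eqOn_deriv_deriv_of_eqOn hJ hEc hc hE self_mem_Ici]
    simp
  · have h1 := hs.right 0 le_rfl
    have hx := dx_initial_eq_zero (hW.differentiable two_ne_zero) hW0
    have hxx := dx_initial_eq_zero ((contDiff_dx hW).differentiable one_ne_zero) hx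
    have htt := hWf (0, l) (h.mem_strip_right le_rfl)
    rw [hxx, mul_zero, sub_zero] at htt
    rw [htt, hx] at h1
    simp only [mul_zero, sub_zero, add_zero] at h1
    linarith

end LeftDefect

end System

/-! ### The characteristic formulas. -/

section Formula

variable {a b l : ℝ} {Γ γ φ ψ μ₁ μ₂ g p : ℝ → ℝ} {w V : ℝ × ℝ → ℝ}

theorem SlowCurve.phiMinus_spec (h : SlowCurve a l Γ) (hγ : EqOn γ Γ (Ici 0)) {z : ℝ}
    (hz : z ≤ 0) : 0 ≤ phiMinus a γ z ∧ Γ (phiMinus a γ z) - a * phiMinus a γ z = z := by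
  obtain ⟨Φ, -, hΦm, hΦ, hΦ'⟩ := h.exists_minus_inverse
  have hΦ0 : Φ 0 = 0 := by simpa [h.zero] using hΦ' 0
  have hex : ∃ t ∈ Ici (0 : ℝ), gammaMinus a γ t = z := by
    have h0 : 0 ≤ Φ z := hΦ0 ▸ hΦm.antitone hz
    exact ⟨Φ z, h0, by rw [gammaMinus, hγ (mem_Ici.2 h0), hΦ]⟩
  have h1 : 0 ≤ phiMinus a γ z := Function.invFunOn_mem hex
  have h2 : gammaMinus a γ (phiMinus a γ z) = z := Function.invFunOn_eq hex
  refine ⟨h1, ?_⟩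
  rwa [gammaMinus, hγ (mem_Ici.2 h1)] at h2

theorem SlowCurve.uniqueDiffOn_gDom (h : SlowCurve a l Γ) (hγ : EqOn γ Γ (Ici 0)) (n : ℕ) :
    UniqueDiffOn ℝ (gDom a l γ n) := by
  cases n with
  | zero => exact uniqueDiffOn_Icc h.length_pos
  | succ n =>
    refine uniqueDiffOn_Icc ?_
    rw [gammaMinus_rNode h hγ, gammaMinus_rNode h hγ]
    exact (h.charNodes hγ).strictAnti_minus h (Nat.lt_succ_self n)

theorem SlowCurve.uniqueDiffOn_pDom (h : SlowCurve a l Γ) (hγ : EqOn γ Γ (Ici 0)) (n : ℕ) :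
    UniqueDiffOn ℝ (pDom a l γ n) := by
  cases n with
  | zero => exact uniqueDiffOn_Icc h.length_pos
  | succ n => exact uniqueDiffOn_Icc ((h.charNodes hγ).strictMono_L h (Nat.lt_succ_self n))

/-- Writing the left end of $P_n$ as $\gamma_+(r_n)$ covers $n=0$ too, since $\gamma_+(r_0)=0$ and
$\gamma_+(r_{n+1})=L_{n+1}$ in the notation of the statement. -/
theorem SlowCurve.mem_pDom (h : SlowCurve a l Γ) (hγ : EqOn γ Γ (Ici 0)) {n : ℕ} {y : ℝ}
    (h1 : Γ (rNode a l γ n) + a * rNode a l γ n ≤ y) (h2 : y ≤ l + a * lNode a l γ n) :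
    y ∈ pDom a l γ n := by
  have hn := h.charNodes hγ
  cases n with
  | zero =>
    have h3 := hn.L_zero
    beta_reduce at h3
    rw [hn.r_zero, h.zero] at h1
    exact ⟨by simpa using h1, h3 ▸ h2⟩
  | succ n =>
    rw [hn.r_succ] at h1
    exact ⟨h1, h2⟩

/-- Reflection in the wall takes $P_{n+1}$ to $G_n$, because the node $l+al_{n+1}$ is the mirror
image of $\gamma_-(r_n)$. Hence the source of the ODE on $P_{n+1}$ involves only $g^{(n)}$. -/
theorem SlowCurve.mem_gDom (h : SlowCurve a l Γ) (hγ : EqOn γ Γ (Ici 0)) {n : ℕ} {y : ℝ}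
    (h1 : l + a * lNode a l γ n ≤ y) (h2 : y ≤ l + a * lNode a l γ (n + 1)) :
    2 * l - y ∈ gDom a l γ n := by
  have hn := h.charNodes hγ
  have h3 := hn.L_succ n
  beta_reduce at h3
  cases n with
  | zero =>
    have h4 := hn.L_zero
    beta_reduce at h4
    rw [hn.r_zero, h.zero] at h3
    exact ⟨by linarith, by linarith⟩
  | succ n =>
    have h4 := hn.L_succ n
    beta_reduce at h4
    rw [gDom, gammaMinus_rNode h hγ, gammaMinus_rNode h hγ]
    exact ⟨by linarith, by linarith⟩

/-- Variation of constants for `a² p'' + b p' = F`. -/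
theorem integral_exp_eq (ha : 0 < a) (hp : ContDiff ℝ 2 p) (L y : ℝ) {F : ℝ → ℝ}
    (hF : ∀ ξ ∈ uIcc L y, F ξ = a ^ 2 * deriv (deriv p) ξ + b * deriv p ξ) :
    (∫ η in L..y, Real.exp (b * (L - η) / a ^ 2) *
      (deriv p L + ∫ ξ in L..η, (a ^ 2)⁻¹ * Real.exp (b * (ξ - L) / a ^ 2) * F ξ)) =
      p y - p L := by
  have hp1 : Continuous (deriv p) := (contDiff_one_deriv hp).continuous
  have hp2 := continuous_deriv_deriv hp
  -- With the integrating factor $e^{b(\xi-L)/a^2}$ the inner integrand is the derivative of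
  -- $e^{b(\xi-L)/a^2}p'(\xi)$.
  have inner : ∀ η ∈ uIcc L y,
      (∫ ξ in L..η, (a ^ 2)⁻¹ * Real.exp (b * (ξ - L) / a ^ 2) * F ξ) =
        Real.exp (b * (η - L) / a ^ 2) * deriv p η - deriv p L := by
    intro η hη
    have hd : ∀ ξ, HasDerivAt (fun ξ => Real.exp (b * (ξ - L) / a ^ 2) * deriv p ξ)
        ((a ^ 2)⁻¹ * Real.exp (b * (ξ - L) / a ^ 2) *
          (a ^ 2 * deriv (deriv p) ξ + b * deriv p ξ)) ξ := fun ξ => by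
      have h1 : HasDerivAt (fun ξ => b * (ξ - L) / a ^ 2) (b / a ^ 2) ξ := by
        simpa using (((hasDerivAt_id ξ).sub_const L).const_mul b).div_const (a ^ 2)
      refine (h1.exp.mul (hasDerivAt_deriv_of_contDiff_two hp ξ)).congr_deriv ?_
      field_simp
      ring
    rw [intervalIntegral.integral_congr (g := fun ξ => (a ^ 2)⁻¹ *
        Real.exp (b * (ξ - L) / a ^ 2) * (a ^ 2 * deriv (deriv p) ξ + b * deriv p ξ))
        fun ξ hξ => by
          beta_reduce
          rw [hF ξ (uIcc_subset_uIcc_left hη hξ)],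
      intervalIntegral.integral_eq_sub_of_hasDerivAt (fun ξ _ => hd ξ)
        (by apply Continuous.intervalIntegrable; fun_prop)]
    simp
  rw [intervalIntegral.integral_congr (g := deriv p) fun η hη => by
      rw [inner η hη, add_sub_cancel, ← mul_assoc, ← Real.exp_add]
      rw [show b * (L - η) / a ^ 2 + b * (η - L) / a ^ 2 = 0 by ring, Real.exp_zero, one_mul],
    intervalIntegral.integral_eq_sub_of_hasDerivAt (fun ξ _ => hasDerivAt_of_contDiff_two hp ξ)
      (hp1.intervalIntegrable _ _)]

/-- Induction on the interval. The left condition at time $\Phi_-(z)$ expresses $g(z)$ through $p$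
on the preceding interval; the right condition is a linear second-order ODE for $p$ whose source
uses $g$ on the mirror interval and whose initial values at the node come from the preceding $p$.
The value $g(0)$ fixes the constant that can be moved between the two waves. -/
theorem WaveSystem.eqOn_gFun_pFun (h : SlowCurve a l Γ) (hγ : EqOn γ Γ (Ici 0))
    (hV : ContDiff ℝ 2 V) (hw : EqOn w V (strip l Γ)) (hg : ContDiff ℝ 2 g) (hp : ContDiff ℝ 2 p)
    (hs : WaveSystem a b l Γ φ ψ μ₁ μ₂ V g p) {C : ℝ} (hC : g 0 = φ 0 / 2 + C) (n : ℕ) :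
    EqOn (gFun a b l γ φ ψ μ₁ μ₂ w C n) g (gDom a l γ n) ∧
      EqOn (pFun a b l γ φ ψ μ₁ μ₂ w C n) p (pDom a l γ n) := by
  have ha := h.speed_pos
  have hl := h.length_pos
  have hn := h.charNodes hγ
  have hud := h.uniqueDiffOn_strip
  induction n with
  | zero =>
    -- The term $2aC$ is $-a(p(0)-g(0))$, from $g(0)+p(0)=\varphi(0)$ and the normalisation of
    -- $g(0)$.
    have hint : ∀ z ∈ Icc 0 l, (∫ ξ in (0 : ℝ)..z, ψ ξ) = a * (p z - g z) + 2 * a * C := by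
      intro z hz
      have hsub : uIcc 0 z ⊆ Icc 0 l := by
        rw [uIcc_of_le hz.1]; exact Icc_subset_Icc_right hz.2
      have hp1 := (contDiff_one_deriv hp).continuous
      have hg1 := (contDiff_one_deriv hg).continuous
      rw [intervalIntegral.integral_congr (g := fun ξ => a * (deriv p ξ - deriv g ξ))
          fun ξ hξ => (hs.initial_dt ξ (hsub hξ)).symm,
        intervalIntegral.integral_eq_sub_of_hasDerivAt
          (f := fun ξ => a * (p ξ - g ξ)) (fun ξ _ => ((hasDerivAt_of_contDiff_two hp ξ).sub
            (hasDerivAt_of_contDiff_two hg ξ)).const_mul a)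
          (by apply Continuous.intervalIntegrable; fun_prop)]
      have h0 := hs.initial 0 ⟨le_rfl, hl.le⟩
      linear_combination (-a) * h0 + 2 * a * hC
    refine ⟨fun z hz => ?_, fun z hz => ?_⟩
    · have e : gFun a b l γ φ ψ μ₁ μ₂ w C 0 z =
        φ z / 2 - 1 / (2 * a) * (∫ ξ in (0 : ℝ)..z, ψ ξ) + C := rfl
      rw [e, hint z hz, ← hs.initial z hz]
      field_simp
      ring
    · have e : pFun a b l γ φ ψ μ₁ μ₂ w C 0 z =
        φ z / 2 + 1 / (2 * a) * (∫ ξ in (0 : ℝ)..z, ψ ξ) - C := rfl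
      rw [e, hint z hz, ← hs.initial z hz]
      field_simp
      ring
  | succ n ih =>
    obtain ⟨ihg, ihp⟩ := ih
    refine ⟨fun z hz => ?_, fun y hy => ?_⟩
    · have e : gFun a b l γ φ ψ μ₁ μ₂ w C (n + 1) z = μ₁ (phiMinus a γ z)
          - pFun a b l γ φ ψ μ₁ μ₂ w C n (γ (phiMinus a γ z) + a * phiMinus a γ z)
          - w (phiMinus a γ z, γ (phiMinus a γ z)) := rfl
      rw [gDom, gammaMinus_rNode h hγ, gammaMinus_rNode h hγ] at hz
      have hz0 : z ≤ 0 := by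
        refine hz.2.trans ?_
        have := h.strictAnti_minus.antitone (hn.r_nonneg n)
        simpa [h.zero] using this
      obtain ⟨ht, hte⟩ := h.phiMinus_spec hγ hz0
      rw [e]
      generalize phiMinus a γ z = t at ht hte
      -- For $z\in G_{n+1}$ the reflection time lies in $[r_n,r_{n+1}]$, so the incoming
      -- characteristic carries a value in $P_n$, where the induction hypothesis applies.
      have h1 : rNode a l γ n ≤ t := by
        refine h.strictAnti_minus.le_iff_ge.1 ?_
        rw [hte]; exact hz.2
      have h2 : t ≤ rNode a l γ (n + 1) := by
        refine h.strictAnti_minus.le_iff_ge.1 ?_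
        rw [hte]; exact hz.1
      have h3 := h.strictMono_plus.monotone h1
      have h4 := h.strictMono_plus.monotone h2
      beta_reduce at h3 h4
      rw [hn.r_succ] at h4
      rw [hγ (mem_Ici.2 ht), ihp (h.mem_pDom hγ h3 h4), hw (h.mem_strip_left ht), ← hs.left t ht,
        hte]
      ring
    · set L := l + a * lNode a l γ n with hL
      have e : pFun a b l γ φ ψ μ₁ μ₂ w C (n + 1) y = pFun a b l γ φ ψ μ₁ μ₂ w C n L
          + ∫ η in L..y, Real.exp (b * (L - η) / a ^ 2) *
            (derivWithin (pFun a b l γ φ ψ μ₁ μ₂ w C n) (pDom a l γ n) L +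
            ∫ ξ in L..η, (a ^ 2)⁻¹ * Real.exp (b * (ξ - L) / a ^ 2) *
              (μ₂ ((ξ - l) / a)
                - a ^ 2 * iteratedDerivWithin 2 (gFun a b l γ φ ψ μ₁ μ₂ w C n) (gDom a l γ n)
                  (2 * l - ξ)
                - b * derivWithin (gFun a b l γ φ ψ μ₁ μ₂ w C n) (gDom a l γ n) (2 * l - ξ)
                - b * dx (closure (halfStrip l γ)) w ((ξ - l) / a, l)
                - dt (closure (halfStrip l γ)) (dt (closure (halfStrip l γ)) w)
                  ((ξ - l) / a, l))) := by
        rfl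
      have hlL : l ≤ L := by
        have := (hn.strictMono_L h).monotone (Nat.zero_le n)
        rwa [hn.L_zero] at this
      have hmL : L ∈ pDom a l γ n := by
        refine h.mem_pDom hγ ?_ le_rfl
        rw [hL, ← hn.r_succ n]
        exact h.strictMono_plus.monotone ((hn.strictMono_r h).monotone (Nat.le_succ n))
      rw [e, ihp hmL, derivWithin_eq_deriv_of_eqOn (h.uniqueDiffOn_pDom hγ n)
        (hp.differentiable two_ne_zero) ihp hmL, halfStrip_congr hγ, h.closure_halfStrip,
        integral_exp_eq ha hp, add_sub_cancel]
      intro ξ hξ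
      rw [uIcc_of_le hy.1] at hξ
      have ht : 0 ≤ (ξ - l) / a := div_nonneg (by linarith [hξ.1]) ha.le
      have hat : a * ((ξ - l) / a) = ξ - l := by field_simp
      have hm := h.mem_gDom hγ hξ.1 (hξ.2.trans hy.2)
      have hr := hs.right _ ht
      rw [hat, add_sub_cancel, show l - (ξ - l) = 2 * l - ξ by ring] at hr
      rw [derivWithin_eq_deriv_of_eqOn (h.uniqueDiffOn_gDom hγ n)
        (hg.differentiable two_ne_zero) ihg hm,
        iteratedDerivWithin_two_eq_of_eqOn (h.uniqueDiffOn_gDom hγ n) hg ihg hm,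
        dt_dt_eq_of_eqOn hud hV hw (h.mem_strip_right ht),
        dx_eq_of_eqOn hud (hV.differentiable two_ne_zero) hw (h.mem_strip_right ht), ← hr]
      ring

/-- The characteristic formulas hold for every solution and every particular solution `w`. -/
theorem SolvesMixed.eq_of_mem_closure_cell {f u W : ℝ × ℝ → ℝ} (h : SlowCurve a l Γ)
    (hγ : EqOn γ Γ (Ici 0)) (hW : ContDiff ℝ 2 W)
    (hWf : ∀ q ∈ strip l Γ, dt univ (dt univ W) q - a ^ 2 * dx univ (dx univ W) q = f q)
    (hu : SolvesMixed a b l Γ φ ψ μ₁ μ₂ f u) (hw : SolvesCauchy a l Γ 0 0 f w)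
    (C : ℝ) (i j : ℕ) {q : ℝ × ℝ} (hq : q ∈ closure (cell a l γ i j)) :
    u q = w q + gFun a b l γ φ ψ μ₁ μ₂ w C i (q.2 - a * q.1)
      + pFun a b l γ φ ψ μ₁ μ₂ w C j (q.2 + a * q.1) := by
  obtain ⟨g₁, p₁, hg₁, hp₁, hw₁⟩ := h.exists_waves hW hWf hw
  obtain ⟨g₂, p₂, hg₂, hp₂, hu₂⟩ := h.exists_waves hW hWf hu.toSolvesCauchy
  -- The arbitrary $w$ is only $C^2$ on the closed strip; being itself $W$ plus two waves, it has
  -- the extension $V$ to the plane, and $u$ is $V$ plus the differences of the waves.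
  set V := withWaves a W g₁ p₁ with hVdef
  have hV : ContDiff ℝ 2 V := contDiff_withWaves hW hg₁ hp₁
  -- The profiles are free up to opposite constants; this one imposes $g(0)=\varphi(0)/2+C$.
  set c := φ 0 / 2 + C - (g₂ 0 - g₁ 0) with hc
  set g : ℝ → ℝ := fun z => g₂ z - g₁ z + c with hgdef
  set p : ℝ → ℝ := fun y => p₂ y - p₁ y - c with hpdef
  have hg : ContDiff ℝ 2 g := (hg₂.sub hg₁).add contDiff_const
  have hp : ContDiff ℝ 2 p := (hp₂.sub hp₁).sub contDiff_const
  have huV : EqOn u (withWaves a V g p) (strip l Γ) := fun q hq => by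
    rw [hu₂ hq]
    simp only [withWaves, hVdef, hgdef, hpdef]; ring
  have hV0 : ∀ x ∈ Icc 0 l, V (0, x) = 0 := fun x hx => by
    rw [← hw₁ (h.mem_strip_initial hx), hw.initial x hx]; rfl
  have hVt0 : ∀ x ∈ Icc 0 l, dt univ V (0, x) = 0 := fun x hx => by
    have := hw.initial_dt x hx
    rw [h.closure_halfStrip] at this
    rw [← dt_eq_of_eqOn h.uniqueDiffOn_strip (hV.differentiable two_ne_zero) hw₁
      (h.mem_strip_initial hx), this]; rfl
  have hs := hu.waveSystem h hV hV0 hVt0 hg hp huV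
  have hgC : g 0 = φ 0 / 2 + C := by simp only [hgdef, hc]; ring
  obtain ⟨hqS, hqg, hqp⟩ := mem_of_mem_closure_cell h hγ hq
  rw [(hs.eqOn_gFun_pFun h hγ hV hw₁ hg hp hgC i).1 hqg,
    (hs.eqOn_gFun_pFun h hγ hV hw₁ hg hp hgC j).2 hqp, huV hqS, hw₁ hqS]
  rfl

end Formula

/-! ### Existence by successive reflections. -/

section Existence

/-- The solution of `a² y'' + b y' = m` with zero data at `l`. -/
noncomputable def odeSolution (a b l : ℝ) (m : ℝ → ℝ) (y : ℝ) : ℝ :=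
  ∫ η in l..y, Real.exp (-(b / a ^ 2 * η)) *
    ∫ ξ in l..η, (a ^ 2)⁻¹ * (Real.exp (b / a ^ 2 * ξ) * m ξ)

section Ode

variable {a b l : ℝ} {m : ℝ → ℝ}

theorem hasDerivAt_odeSolution_integrand (hm : Continuous m) (y : ℝ) :
    HasDerivAt (fun η => Real.exp (-(b / a ^ 2 * η)) *
      ∫ ξ in l..η, (a ^ 2)⁻¹ * (Real.exp (b / a ^ 2 * ξ) * m ξ))
      ((a ^ 2)⁻¹ * m y - b / a ^ 2 * (Real.exp (-(b / a ^ 2 * y)) *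
        ∫ ξ in l..y, (a ^ 2)⁻¹ * (Real.exp (b / a ^ 2 * ξ) * m ξ))) y := by
  have h1 : HasDerivAt (fun η => Real.exp (-(b / a ^ 2 * η)))
      (Real.exp (-(b / a ^ 2 * y)) * -(b / a ^ 2)) y := by
    simpa using ((hasDerivAt_id y).const_mul (b / a ^ 2)).fun_neg.exp
  have h2 := hasDerivAt_integral_of_continuous
    (by fun_prop : Continuous fun ξ => (a ^ 2)⁻¹ * (Real.exp (b / a ^ 2 * ξ) * m ξ)) l y
  refine (h1.mul h2).congr_deriv ?_
  have : Real.exp (-(b / a ^ 2 * y)) * ((a ^ 2)⁻¹ * (Real.exp (b / a ^ 2 * y) * m y)) =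
      (a ^ 2)⁻¹ * m y := by
    rw [show Real.exp (-(b / a ^ 2 * y)) * ((a ^ 2)⁻¹ * (Real.exp (b / a ^ 2 * y) * m y)) =
      (Real.exp (-(b / a ^ 2 * y)) * Real.exp (b / a ^ 2 * y)) * ((a ^ 2)⁻¹ * m y) by ring,
      ← Real.exp_add, neg_add_cancel, Real.exp_zero, one_mul]
  rw [this]
  ring

theorem continuous_odeSolution_integrand (hm : Continuous m) :
    Continuous fun η => Real.exp (-(b / a ^ 2 * η)) *
      ∫ ξ in l..η, (a ^ 2)⁻¹ * (Real.exp (b / a ^ 2 * ξ) * m ξ) :=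
  continuous_iff_continuousAt.2 fun y => (hasDerivAt_odeSolution_integrand hm y).continuousAt

theorem deriv_odeSolution (hm : Continuous m) :
    deriv (odeSolution a b l m) = fun η => Real.exp (-(b / a ^ 2 * η)) *
      ∫ ξ in l..η, (a ^ 2)⁻¹ * (Real.exp (b / a ^ 2 * ξ) * m ξ) :=
  funext fun y =>
    (hasDerivAt_integral_of_continuous (continuous_odeSolution_integrand hm) l y).deriv

theorem contDiff_odeSolution (hm : Continuous m) :
    ContDiff ℝ 2 (odeSolution a b l m) := by
  have hc := continuous_odeSolution_integrand (a := a) (b := b) (l := l) hm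
  exact contDiff_two_of_hasDerivAt (fun y => hasDerivAt_integral_of_continuous hc l y)
    (contDiff_one_of_hasDerivAt (hasDerivAt_odeSolution_integrand hm)
      ((hm.const_mul _).sub (hc.const_mul _)))

theorem odeSolution_spec (ha : 0 < a) (hm : Continuous m) (y : ℝ) :
    a ^ 2 * deriv (deriv (odeSolution a b l m)) y + b * deriv (odeSolution a b l m) y = m y := by
  rw [deriv_odeSolution hm, (hasDerivAt_odeSolution_integrand hm y).deriv]
  field_simp
  ring

/-- Causality: up to $Y\ge l$ both integrals see the source only on $(-\infty,Y]$. -/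
theorem odeSolution_congr {m' : ℝ → ℝ} {Y : ℝ} (hY : l ≤ Y) (h : EqOn m m' (Iic Y)) :
    EqOn (odeSolution a b l m) (odeSolution a b l m') (Iic Y) := by
  intro y hy
  have hsub : ∀ η ∈ Iic Y, uIcc l η ⊆ Iic Y := fun η hη ξ hξ =>
    hξ.2.trans (sup_le hY hη)
  refine intervalIntegral.integral_congr fun η hη => ?_
  congr 1
  refine intervalIntegral.integral_congr fun ξ hξ => ?_
  rw [h (hsub η (hsub y hy hη) hξ)]

theorem odeSolution_zero (y : ℝ) : odeSolution a b l (fun _ => 0) y = 0 := by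
  simp [odeSolution]

end Ode

/-- The defect of the boundary condition on the fixed boundary. -/
noncomputable def rightDefect (a b l : ℝ) (N : ℝ → ℝ) (W : ℝ × ℝ → ℝ) (g p : ℝ → ℝ) (t : ℝ) : ℝ :=
  N t - dt univ (dt univ W) (t, l) - b * dx univ W (t, l)
    - a ^ 2 * (deriv (deriv g) (l - a * t) + deriv (deriv p) (l + a * t))
    - b * (deriv g (l - a * t) + deriv p (l + a * t))

/-- The wave reflected from the moving boundary when the incoming wave is `p`; the initial profile
is `g₀` and `Φ` is the inverse of `t ↦ Γ t - a t`. -/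
noncomputable def leftReflect (a : ℝ) (Γ M : ℝ → ℝ) (W : ℝ × ℝ → ℝ) (g₀ Φ p : ℝ → ℝ) (z : ℝ) : ℝ :=
  g₀ z + positivePart (leftDefect a Γ M W g₀ p) (Φ z)

/-- The wave reflected from the fixed boundary when the incoming wave is `g`; the initial profile
is `p₀`. -/
noncomputable def rightReflect (a b l : ℝ) (N : ℝ → ℝ) (W : ℝ × ℝ → ℝ) (p₀ g : ℝ → ℝ) (y : ℝ) : ℝ :=
  p₀ y + odeSolution a b l (fun ξ => positivePart (rightDefect a b l N W g p₀) ((ξ - l) / a)) y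

section Reflect

variable {a b l : ℝ} {Γ M N Φ g p g₀ p₀ : ℝ → ℝ} {W : ℝ × ℝ → ℝ}

theorem positivePart_of_nonneg {E : ℝ → ℝ} {t : ℝ} (ht : 0 ≤ t) : positivePart E t = E t :=
  if_pos ht

theorem positivePart_of_nonpos {E : ℝ → ℝ} {t : ℝ} (h0 : E 0 = 0) (ht : t ≤ 0) :
    positivePart E t = 0 := by
  rcases ht.lt_or_eq with h | rfl
  · exact if_neg (not_le.2 h)
  · rw [positivePart_of_nonneg le_rfl, h0]

theorem leftDefect_eventuallyEq (h : SlowCurve a l Γ) (hpp : EqOn p p₀ (Iic l)) :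
    leftDefect a Γ M W g₀ p =ᶠ[𝓝 0] leftDefect a Γ M W g₀ p₀ := by
  have hΓ := h.continuous
  have hc : Continuous fun t => Γ t + a * t := by fun_prop
  have : Iio l ∈ 𝓝 (Γ 0 + a * 0) := by
    rw [h.zero]; simpa using Iio_mem_nhds h.length_pos
  filter_upwards [hc.continuousAt.preimage_mem_nhds this] with t ht
  simp only [leftDefect]
  rw [hpp (mem_Iic.2 (le_of_lt (mem_Iio.1 ht)))]

/-- Near $t=0$ one has $\Gamma(t)+at<l$, where the incoming wave is still $p_0$. Its error therefore
has the same 2-jet at $0$ as that of the initial profiles, namely zero, and can be truncated. -/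
theorem contDiff_leftReflect (h : SlowCurve a l Γ) (hM : ContDiff ℝ 2 M) (hW : ContDiff ℝ 2 W)
    (hΦ : ContDiff ℝ 2 Φ) (hg₀ : ContDiff ℝ 2 g₀) (hp : ContDiff ℝ 2 p)
    (hpp : EqOn p p₀ (Iic l)) (h0 : leftDefect a Γ M W g₀ p₀ 0 = 0)
    (h1 : deriv (leftDefect a Γ M W g₀ p₀) 0 = 0)
    (h2 : deriv (deriv (leftDefect a Γ M W g₀ p₀)) 0 = 0) :
    ContDiff ℝ 2 (leftReflect a Γ M W g₀ Φ p) := by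
  have he := leftDefect_eventuallyEq (M := M) (W := W) (g₀ := g₀) h hpp
  exact hg₀.add ((contDiff_two_positivePart (contDiff_leftDefect h hM hW hg₀ hp)
    (by rw [he.eq_of_nhds, h0]) (by rw [he.deriv_eq, h1]) (by rw [he.deriv.deriv_eq, h2])).comp hΦ)

theorem leftReflect_eqOn (h : SlowCurve a l Γ) (hΦm : StrictAnti Φ)
    (hΦ : ∀ t, Φ (Γ t - a * t) = t) (hpp : EqOn p p₀ (Iic l))
    (h0 : leftDefect a Γ M W g₀ p₀ 0 = 0) :
    EqOn (leftReflect a Γ M W g₀ Φ p) g₀ (Ici 0) := by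
  intro z hz
  have hΦ0 : Φ 0 = 0 := by simpa [h.zero] using hΦ 0
  have hz' : Φ z ≤ 0 := hΦ0 ▸ hΦm.antitone hz
  have he := leftDefect_eventuallyEq (M := M) (W := W) (g₀ := g₀) h hpp
  rw [leftReflect, positivePart_of_nonpos (by rw [he.eq_of_nhds, h0]) hz', add_zero]

theorem leftReflect_boundary (hΦ : ∀ t, Φ (Γ t - a * t) = t) {t : ℝ} (ht : 0 ≤ t) :
    leftReflect a Γ M W g₀ Φ p (Γ t - a * t) = M t - W (t, Γ t) - p (Γ t + a * t) := by
  rw [leftReflect, hΦ, positivePart_of_nonneg ht, leftDefect]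
  ring

/-- Finite speed of propagation at the curve: what leaves up to time $r$ depends on what arrives up
to time $r$. -/
theorem leftReflect_congr (h : SlowCurve a l Γ) (hΦm : StrictAnti Φ)
    (hΦ : ∀ t, Φ (Γ t - a * t) = t) {p' : ℝ → ℝ} {r : ℝ}
    (hpp : EqOn p p' (Iic (Γ r + a * r))) :
    EqOn (leftReflect a Γ M W g₀ Φ p) (leftReflect a Γ M W g₀ Φ p') (Ici (Γ r - a * r)) := by
  intro z hz
  have hz' : Φ z ≤ r := hΦ r ▸ hΦm.antitone hz
  have hm := h.strictMono_plus.monotone hz'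
  simp only [leftReflect, positivePart, leftDefect]
  rw [hpp hm]

theorem continuous_rightDefect (hN : Continuous N) (hW : ContDiff ℝ 2 W)
    (hg : ContDiff ℝ 2 g) (hp : ContDiff ℝ 2 p) : Continuous (rightDefect a b l N W g p) := by
  have h1 := continuous_dt (contDiff_dt hW)
  have h2 := (contDiff_dx hW).continuous
  have h3 := continuous_deriv_deriv hg
  have h4 := continuous_deriv_deriv hp
  have h5 := (contDiff_one_deriv hg).continuous
  have h6 := (contDiff_one_deriv hp).continuous
  unfold rightDefect
  fun_prop

theorem rightDefect_zero (hl : 0 < l) (hg : ContDiff ℝ 2 g) (hg₀ : ContDiff ℝ 2 g₀)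
    (hgg : EqOn g g₀ (Ici 0)) :
    rightDefect a b l N W g p₀ 0 = rightDefect a b l N W g₀ p₀ 0 := by
  have hl' : l - a * 0 ∈ Ici (0 : ℝ) := by simpa using hl.le
  simp only [rightDefect]
  rw [eqOn_deriv_deriv_of_eqOn (uniqueDiffOn_Ici 0) hg hg₀ hgg hl',
    eqOn_deriv_of_eqOn (uniqueDiffOn_Ici 0) (hg.differentiable two_ne_zero)
      (hg₀.differentiable two_ne_zero) hgg hl']

theorem continuous_rightSource (hN : Continuous N) (hW : ContDiff ℝ 2 W)
    (hg : ContDiff ℝ 2 g) (hp₀ : ContDiff ℝ 2 p₀) (h0 : rightDefect a b l N W g p₀ 0 = 0) :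
    Continuous fun ξ => positivePart (rightDefect a b l N W g p₀) ((ξ - l) / a) :=
  (continuous_positivePart (continuous_rightDefect hN hW hg hp₀) h0).comp (by fun_prop)

theorem contDiff_rightReflect (hN : Continuous N) (hW : ContDiff ℝ 2 W)
    (hg : ContDiff ℝ 2 g) (hp₀ : ContDiff ℝ 2 p₀) (h0 : rightDefect a b l N W g p₀ 0 = 0) :
    ContDiff ℝ 2 (rightReflect a b l N W p₀ g) :=
  hp₀.add (contDiff_odeSolution (continuous_rightSource hN hW hg hp₀ h0))

theorem rightReflect_eqOn (ha : 0 < a) (h0 : rightDefect a b l N W g p₀ 0 = 0) :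
    EqOn (rightReflect a b l N W p₀ g) p₀ (Iic l) := by
  intro y hy
  rw [rightReflect, odeSolution_congr (m' := fun _ => 0) le_rfl (fun ξ hξ => ?_) hy,
    odeSolution_zero, add_zero]
  exact positivePart_of_nonpos h0 (div_nonpos_of_nonpos_of_nonneg (sub_nonpos.2 hξ) ha.le)

/-- The correction added to $p_0$ solves $a^2y''+by'=$ the error left by $g$ and $p_0$, so it
cancels that error for $t\ge0$. -/
theorem rightReflect_boundary (ha : 0 < a) (hN : Continuous N) (hW : ContDiff ℝ 2 W)
    (hg : ContDiff ℝ 2 g) (hp₀ : ContDiff ℝ 2 p₀) (h0 : rightDefect a b l N W g p₀ 0 = 0)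
    {t : ℝ} (ht : 0 ≤ t) :
    dt univ (dt univ W) (t, l) + b * dx univ W (t, l)
      + a ^ 2 * (deriv (deriv g) (l - a * t)
        + deriv (deriv (rightReflect a b l N W p₀ g)) (l + a * t))
      + b * (deriv g (l - a * t) + deriv (rightReflect a b l N W p₀ g) (l + a * t)) = N t := by
  have hm := continuous_rightSource hN hW hg hp₀ h0
  have he := contDiff_odeSolution (a := a) (b := b) (l := l) hm
  set e := odeSolution a b l
    (fun ξ => positivePart (rightDefect a b l N W g p₀) ((ξ - l) / a)) with hedef
  have d1 : deriv (rightReflect a b l N W p₀ g) = fun y => deriv p₀ y + deriv e y :=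
    funext fun y => ((hasDerivAt_of_contDiff_two hp₀ y).add (hasDerivAt_of_contDiff_two he y)).deriv
  have d2 : deriv (deriv (rightReflect a b l N W p₀ g)) =
      fun y => deriv (deriv p₀) y + deriv (deriv e) y := by
    rw [d1]
    exact funext fun y => ((hasDerivAt_deriv_of_contDiff_two hp₀ y).add
      (hasDerivAt_deriv_of_contDiff_two he y)).deriv
  have h1 := odeSolution_spec (b := b) (l := l) ha hm (l + a * t)
  rw [← hedef, add_sub_cancel_left, mul_div_cancel_left₀ _ ha.ne', positivePart_of_nonneg ht,
    rightDefect] at h1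
  rw [d2, d1]
  linarith

/-- Finite speed of propagation at the wall, where the incoming argument $\zeta$ corresponds to the
outgoing argument $2l-\zeta$. -/
theorem rightReflect_congr (ha : 0 < a) {g' : ℝ → ℝ} {ζ : ℝ} (hζ : ζ ≤ l)
    (hg : ContDiff ℝ 2 g) (hg' : ContDiff ℝ 2 g') (hgg : EqOn g g' (Ici ζ)) :
    EqOn (rightReflect a b l N W p₀ g) (rightReflect a b l N W p₀ g') (Iic (2 * l - ζ)) := by
  intro y hy
  simp only [rightReflect]
  rw [odeSolution_congr (by linarith) (fun ξ hξ => ?_) hy]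
  have hat : a * ((ξ - l) / a) = ξ - l := by field_simp
  have hm : l - a * ((ξ - l) / a) ∈ Ici ζ := by
    rw [hat, mem_Ici]; linarith [mem_Iic.1 hξ]
  simp only [positivePart, rightDefect]
  rw [eqOn_deriv_deriv_of_eqOn (uniqueDiffOn_Ici ζ) hg hg' hgg hm,
    eqOn_deriv_of_eqOn (uniqueDiffOn_Ici ζ) (hg.differentiable two_ne_zero)
      (hg'.differentiable two_ne_zero) hgg hm]

/-- Successive reflections of the initial profiles. -/
noncomputable def reflections (a b l : ℝ) (Γ M N : ℝ → ℝ) (W : ℝ × ℝ → ℝ) (g₀ p₀ Φ : ℝ → ℝ) :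
    ℕ → (ℝ → ℝ) × (ℝ → ℝ)
  | 0 => (g₀, p₀)
  | n + 1 =>
    (leftReflect a Γ M W g₀ Φ (reflections a b l Γ M N W g₀ p₀ Φ n).2,
      rightReflect a b l N W p₀ (reflections a b l Γ M N W g₀ p₀ Φ n).1)

/-- The wanted pair is a fixed point of the two reflections. Each reflection advances by one node
the region where the iterates are stationary, so the limit exists locally after finitely many steps
and inherits both boundary conditions. -/
theorem exists_reflected_profiles (h : SlowCurve a l Γ) {r L : ℕ → ℝ} (hn : CharNodes a l Γ r L)
    (hM : ContDiff ℝ 2 M) (hN : Continuous N) (hW : ContDiff ℝ 2 W)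
    (hg₀ : ContDiff ℝ 2 g₀) (hp₀ : ContDiff ℝ 2 p₀) (h0 : leftDefect a Γ M W g₀ p₀ 0 = 0)
    (h1 : deriv (leftDefect a Γ M W g₀ p₀) 0 = 0)
    (h2 : deriv (deriv (leftDefect a Γ M W g₀ p₀)) 0 = 0)
    (h3 : rightDefect a b l N W g₀ p₀ 0 = 0) :
    ∃ G P : ℝ → ℝ, ContDiff ℝ 2 G ∧ ContDiff ℝ 2 P ∧ EqOn G g₀ (Ici 0) ∧ EqOn P p₀ (Iic l) ∧
      (∀ t, 0 ≤ t → W (t, Γ t) + G (Γ t - a * t) + P (Γ t + a * t) = M t) ∧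
      ∀ t, 0 ≤ t → dt univ (dt univ W) (t, l) + b * dx univ W (t, l)
        + a ^ 2 * (deriv (deriv G) (l - a * t) + deriv (deriv P) (l + a * t))
        + b * (deriv G (l - a * t) + deriv P (l + a * t)) = N t := by
  have ha := h.speed_pos
  have hl := h.length_pos
  obtain ⟨Φ, hΦc, hΦm, -, hΦ⟩ := h.exists_minus_inverse
  set x := reflections a b l Γ M N W g₀ p₀ Φ with hx
  have hx1 : ∀ n, (x (n + 1)).1 = leftReflect a Γ M W g₀ Φ (x n).2 := fun n => rfl
  have hx2 : ∀ n, (x (n + 1)).2 = rightReflect a b l N W p₀ (x n).1 := fun n => rfl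
  have inv : ∀ n, ContDiff ℝ 2 (x n).1 ∧ ContDiff ℝ 2 (x n).2 ∧ EqOn (x n).1 g₀ (Ici 0) ∧
      EqOn (x n).2 p₀ (Iic l) := by
    intro n
    induction n with
    | zero => exact ⟨hg₀, hp₀, fun _ _ => rfl, fun _ _ => rfl⟩
    | succ n ih =>
      obtain ⟨i1, i2, i3, i4⟩ := ih
      have hd : rightDefect a b l N W (x n).1 p₀ 0 = 0 := by
        rw [rightDefect_zero hl i1 hg₀ i3, h3]
      rw [hx1, hx2]
      exact ⟨contDiff_leftReflect h hM hW hΦc hg₀ i2 i4 h0 h1 h2,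
        contDiff_rightReflect hN hW i1 hp₀ hd, leftReflect_eqOn h hΦm hΦ i4 h0,
        rightReflect_eqOn ha hd⟩
  have hd : ∀ n, rightDefect a b l N W (x n).1 p₀ 0 = 0 := fun n => by
    rw [rightDefect_zero hl (inv n).1 hg₀ (inv n).2.2.1, h3]
  have hr0 : Γ (r 0) - a * r 0 = 0 := by simp [hn.r_zero, h.zero]
  have hrl : ∀ n, Γ (r n) - a * r n ≤ l := fun n => by
    have := (hn.strictAnti_minus h).antitone (Nat.zero_le n)
    beta_reduce at this
    linarith
  -- The regions fit the nodes: agreement of the incoming $p$ up to $L_n=\gamma_+(r_{n+1})$ gives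
  -- agreement of $g$ from $\gamma_-(r_{n+1})$ on, and agreement of $g$ from $\gamma_-(r_n)$ on
  -- gives agreement of $p$ up to $2l-\gamma_-(r_n)=L_{n+1}$.
  have step : ∀ n, EqOn (x (n + 1)).1 (x n).1 (Ici (Γ (r n) - a * r n)) ∧
      EqOn (x (n + 1)).2 (x n).2 (Iic (L n)) := by
    intro n
    induction n with
    | zero =>
      rw [hr0, hn.L_zero]
      exact ⟨(inv 1).2.2.1, (inv 1).2.2.2⟩
    | succ n ih =>
      rw [hx1 (n + 1), hx1 n, hx2 (n + 1), hx2 n, hn.L_succ]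
      refine ⟨leftReflect_congr h hΦm hΦ (by rw [hn.r_succ]; exact ih.2), ?_⟩
      rw [hx1 n] at ih
      exact rightReflect_congr ha (hrl n) (hx1 n ▸ (inv (n + 1)).1) (inv n).1 ih.1
  have hanti := (hn.strictAnti_minus h).antitone
  obtain ⟨G, hG, hGx⟩ := exists_contDiff_two_limit (F := fun n => (x n).1)
    (U := fun n => Ici (Γ (r n) - a * r n)) (fun n m hnm => Ici_subset_Ici.2 (hanti hnm))
    (fun z => by
      obtain ⟨n, hz⟩ := ((hn.tendsto_minus h).eventually_lt_atBot z).exists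
      exact ⟨n, Ici_mem_nhds hz⟩) (fun n => (inv n).1) fun n => (step n).1
  obtain ⟨P, hP, hPx⟩ := exists_contDiff_two_limit (F := fun n => (x n).2)
    (U := fun n => Iic (L n)) (fun n m hnm => Iic_subset_Iic.2 ((hn.strictMono_L h).monotone hnm))
    (fun z => by
      obtain ⟨n, hz⟩ := ((hn.tendsto_L h).eventually_gt_atTop z).exists
      exact ⟨n, Iic_mem_nhds hz⟩) (fun n => (inv n).2.1) fun n => (step n).2
  refine ⟨G, P, hG, hP, ?_, ?_, fun t ht => ?_, fun t ht => ?_⟩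
  · have := hGx 0
    beta_reduce at this
    rwa [hr0] at this
  · have := hPx 0
    beta_reduce at this
    rwa [hn.L_zero] at this
  · obtain ⟨n, htn⟩ := ((hn.tendsto_r h).eventually_ge_atTop t).exists
    have e1 : Γ t - a * t ∈ Ici (Γ (r (n + 1)) - a * r (n + 1)) :=
      h.strictAnti_minus.antitone (htn.trans (hn.lt_succ h n).1.le)
    have e2 : Γ t + a * t ∈ Iic (L n) := by
      rw [← hn.r_succ]
      exact h.strictMono_plus.monotone (htn.trans (hn.lt_succ h n).1.le)
    -- The indices differ by one because the iterate $g_{n+1}$ is the reflection of $p_n$; at the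
    -- wall the roles are exchanged.
    rw [hGx (n + 1) e1, hPx n e2]
    rw [hx1, leftReflect_boundary hΦ ht]
    ring
  · obtain ⟨n, htn⟩ := ((hn.tendsto_L h).eventually_ge_atTop (l + a * t)).exists
    have e2 : l + a * t ∈ Iic (L (n + 1)) := htn.trans (hn.lt_succ h n).2.le
    have e1 : l - a * t ∈ Ici (Γ (r n) - a * r n) := by
      have := hn.L_succ n
      rw [mem_Ici]; linarith [mem_Iic.1 e2]
    rw [eqOn_deriv_deriv_of_eqOn (uniqueDiffOn_Ici _) hG (inv n).1 (hGx n) e1,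
      eqOn_deriv_of_eqOn (uniqueDiffOn_Ici _) (hG.differentiable two_ne_zero)
        ((inv n).1.differentiable two_ne_zero) (hGx n) e1,
      eqOn_deriv_deriv_of_eqOn (uniqueDiffOn_Iic _) hP (inv (n + 1)).2.1 (hPx (n + 1)) e2,
      eqOn_deriv_of_eqOn (uniqueDiffOn_Iic _) (hP.differentiable two_ne_zero)
        ((inv (n + 1)).2.1.differentiable two_ne_zero) (hPx (n + 1)) e2, hx2]
    exact rightReflect_boundary ha hN hW (inv n).1 hp₀ (hd n) ht

end Reflect

theorem exists_initial_profiles {a l : ℝ} (ha : 0 < a) (hl : 0 < l) {φ ψ : ℝ → ℝ}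
    (hφ : ContDiffOn ℝ 2 φ (Icc 0 l)) (hψ : ContDiffOn ℝ 1 ψ (Icc 0 l)) :
    ∃ g p : ℝ → ℝ, ContDiff ℝ 2 g ∧ ContDiff ℝ 2 p ∧ (∀ x ∈ Icc 0 l, g x + p x = φ x) ∧
      ∀ x ∈ Icc 0 l, a * (deriv p x - deriv g x) = ψ x := by
  have hne : (Icc 0 l).Nonempty := nonempty_Icc.2 hl.le
  obtain ⟨f, hf, hfφ⟩ := exists_contDiff_two_extension (convex_Icc 0 l) (uniqueDiffOn_Icc hl)
    isClosed_Icc hne hφ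
  obtain ⟨k, hk, hkψ⟩ := exists_contDiff_one_extension (convex_Icc 0 l) (uniqueDiffOn_Icc hl)
    isClosed_Icc hne hψ
  have hK : ∀ x, HasDerivAt (fun x => (2 * a)⁻¹ * ∫ ξ in (0 : ℝ)..x, k ξ) ((2 * a)⁻¹ * k x) x :=
    fun x => (hasDerivAt_integral_of_continuous hk.continuous 0 x).const_mul _
  have hKc := contDiff_two_of_hasDerivAt hK (contDiff_const.mul hk)
  have hf2 : ∀ x, HasDerivAt (fun x => f x / 2) (deriv f x / 2) x := fun x =>
    (hasDerivAt_of_contDiff_two hf x).div_const 2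
  refine ⟨fun x => f x / 2 - (2 * a)⁻¹ * ∫ ξ in (0 : ℝ)..x, k ξ,
    fun x => f x / 2 + (2 * a)⁻¹ * ∫ ξ in (0 : ℝ)..x, k ξ, (hf.div_const 2).sub hKc,
    (hf.div_const 2).add hKc, fun x hx => ?_, fun x hx => ?_⟩
  · rw [← hfφ hx]; ring
  · rw [((hf2 x).fun_add (hK x)).deriv, ((hf2 x).fun_sub (hK x)).deriv, ← hkψ hx]
    field_simp
    ring

theorem Matching.exists_solvesMixed {a b l : ℝ} {Γ φ ψ μ₁ μ₂ : ℝ → ℝ} {f W : ℝ × ℝ → ℝ}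
    (h : SlowCurve a l Γ) (hφ : ContDiffOn ℝ 2 φ (Icc 0 l)) (hψ : ContDiffOn ℝ 1 ψ (Icc 0 l))
    (hμ₁ : ContDiffOn ℝ 2 μ₁ (Ici 0)) (hμ₂ : ContinuousOn μ₂ (Ici 0)) (hW : ContDiff ℝ 2 W)
    (hWf : ∀ q ∈ strip l Γ, dt univ (dt univ W) q - a ^ 2 * dx univ (dx univ W) q = f q)
    (hW0 : ∀ x, W (0, x) = 0) (hWt0 : ∀ x, dt univ W (0, x) = 0)
    (hm : Matching a b l Γ φ ψ μ₁ μ₂ f) : ∃ u, SolvesMixed a b l Γ φ ψ μ₁ μ₂ f u := by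
  have hl := h.length_pos
  obtain ⟨M, hM, hMμ⟩ := exists_contDiff_two_extension (convex_Ici 0) (uniqueDiffOn_Ici 0)
    isClosed_Ici nonempty_Ici hμ₁
  obtain ⟨N, hN, hNμ⟩ := exists_continuous_extension isClosed_Ici hμ₂
  obtain ⟨g₀, p₀, hg₀, hp₀, i1, i2⟩ := exists_initial_profiles h.speed_pos hl hφ hψ
  obtain ⟨m0, m1, m2, m3⟩ :=
    (matching_iff h hM hMμ.symm hW hWf hW0 hWt0 hg₀ hp₀ i1 i2).1 hm
  have hx := dx_initial_eq_zero (hW.differentiable two_ne_zero) hW0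
  have hxx := dx_initial_eq_zero ((contDiff_dx hW).differentiable one_ne_zero) hx
  have htt := hWf (0, l) (h.mem_strip_right le_rfl)
  rw [hxx, mul_zero, sub_zero] at htt
  -- At $(0,l)$ one has $W_{tt}=f$ and $W_x=0$, so the last matching condition is the vanishing of
  -- the right error.
  have hr : rightDefect a b l N W g₀ p₀ 0 = 0 := by
    rw [← hNμ self_mem_Ici] at m3
    simp only [rightDefect, mul_zero, sub_zero, add_zero, htt, hx]
    linarith
  obtain ⟨G, P, hG, hP, hGg, hPp, e1, e2⟩ := exists_reflected_profiles h
    (h.charNodes (fun _ _ => rfl)) hM hN hW hg₀ hp₀ m0 m1 m2 hr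
  refine ⟨_, WaveSystem.solvesMixed h hW hWf hW0 hWt0 hG hP ⟨fun x hx => ?_, fun x hx => ?_,
    fun t ht => ?_, fun t ht => ?_⟩⟩
  · rw [hGg hx.1, hPp hx.2, i1 x hx]
  · rw [eqOn_deriv_of_eqOn (uniqueDiffOn_Ici 0) (hG.differentiable two_ne_zero)
      (hg₀.differentiable two_ne_zero) hGg hx.1,
      eqOn_deriv_of_eqOn (uniqueDiffOn_Iic l) (hP.differentiable two_ne_zero)
      (hp₀.differentiable two_ne_zero) hPp hx.2, i2 x hx]
  · rw [e1 t ht, hMμ (mem_Ici.2 ht)]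
  · rw [e2 t ht, hNμ (mem_Ici.2 ht)]

end Existence

/-! ### Independence of the extension of the curve to negative times. -/

section Transfer

variable {a b l : ℝ} {Γ γ φ ψ μ₁ μ₂ : ℝ → ℝ} {f u : ℝ × ℝ → ℝ}

theorem solvesCauchy_congr (hγ : EqOn γ Γ (Ici 0)) :
    SolvesCauchy a l γ φ ψ f u ↔ SolvesCauchy a l Γ φ ψ f u := by
  have hS := halfStrip_congr (l := l) hγ
  constructor
  · rintro ⟨h1, h2, h3, h4⟩
    rw [hS] at h1 h2 h4
    exact ⟨h1, h2, h3, h4⟩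
  · rintro ⟨h1, h2, h3, h4⟩
    rw [← hS] at h1 h2 h4
    exact ⟨h1, h2, h3, h4⟩

theorem solvesMixed_congr (hγ : EqOn γ Γ (Ici 0)) :
    SolvesMixed a b l γ φ ψ μ₁ μ₂ f u ↔ SolvesMixed a b l Γ φ ψ μ₁ μ₂ f u := by
  have hS := halfStrip_congr (l := l) hγ
  constructor
  · rintro ⟨h1, h2, h3⟩
    rw [hS] at h3
    exact ⟨(solvesCauchy_congr hγ).1 h1, fun t ht => hγ ht ▸ h2 t ht, h3⟩
  · rintro ⟨h1, h2, h3⟩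
    rw [← hS] at h3
    exact ⟨(solvesCauchy_congr hγ).2 h1, fun t ht => (hγ ht).symm ▸ h2 t ht, h3⟩

theorem matching_congr (hγ : EqOn γ Γ (Ici 0)) :
    Matching a b l γ φ ψ μ₁ μ₂ f ↔ Matching a b l Γ φ ψ μ₁ μ₂ f := by
  have h1 : derivWithin γ (Ici 0) 0 = derivWithin Γ (Ici 0) 0 :=
    derivWithin_congr hγ (hγ self_mem_Ici)
  have h2 : iteratedDerivWithin 2 γ (Ici 0) 0 = iteratedDerivWithin 2 Γ (Ici 0) 0 :=
    iteratedDerivWithin_congr hγ self_mem_Ici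
  constructor
  · rintro ⟨m0, m1, m2, m3⟩
    rw [h1] at m1 m2
    rw [h2] at m2
    exact ⟨m0, m1, m2, m3⟩
  · rintro ⟨m0, m1, m2, m3⟩
    rw [← h1] at m1 m2
    rw [← h2] at m2
    exact ⟨m0, m1, m2, m3⟩

end Transfer

end CurvilinearWave

/-! ### The main theorem. -/

theorem theorem1 (a b l : ℝ) (ha : 0 < a) (hl : 0 < l)
    (γ φ ψ μ₁ μ₂ : ℝ → ℝ) (f : ℝ × ℝ → ℝ)
    (hγ_zero : γ 0 = 0)
    (hγ_lt : ∀ t ∈ Ici (0 : ℝ), γ t < l)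
    (hγ_deriv : ∀ t ∈ Ici (0 : ℝ), derivWithin γ (Ici 0) t ∈ Ioo (-a) a)
    (hγ_plus : Tendsto (fun t => γ t + a * t) atTop atTop)
    (hγ_minus : Tendsto (fun t => γ t - a * t) atTop atBot)
    (hφ : ContDiffOn ℝ 2 φ (Icc 0 l))
    (hψ : ContDiffOn ℝ 1 ψ (Icc 0 l))
    (hμ₁ : ContDiffOn ℝ 2 μ₁ (Ici 0))
    (hμ₂ : ContinuousOn μ₂ (Ici 0))
    (hγ : ContDiffOn ℝ 2 γ (Ici 0))
    (hf : ContDiffOn ℝ 1 f (closure (halfStrip l γ))) :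
    -- a solution exists and is unique (on the closure of `Q`) iff the matching conditions hold
    ((∃ u, SolvesMixed a b l γ φ ψ μ₁ μ₂ f u ∧
        ∀ u', SolvesMixed a b l γ φ ψ μ₁ μ₂ f u' → EqOn u' u (closure (halfStrip l γ)))
      ↔ Matching a b l γ φ ψ μ₁ μ₂ f) ∧
    -- the closed cells cover the closure of `Q`
    closure (halfStrip l γ) = ⋃ (i : ℕ) (j : ℕ), closure (cell a l γ i j) ∧
    -- a particular solution with zero Cauchy data exists
    (∃ w, SolvesCauchy a l γ 0 0 f w) ∧
    -- whichever one is used, the solution is given by the characteristic formulas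
    (∀ u, SolvesMixed a b l γ φ ψ μ₁ μ₂ f u →
      ∀ w, SolvesCauchy a l γ 0 0 f w → ∀ (C : ℝ) (i j : ℕ),
        ∀ q ∈ closure (cell a l γ i j),
          u q = w q + gFun a b l γ φ ψ μ₁ μ₂ w C i (q.2 - a * q.1)
            + pFun a b l γ φ ψ μ₁ μ₂ w C j (q.2 + a * q.1)) := by

  obtain ⟨Γ, h, hΓ⟩ := exists_slowCurve ha hl hγ_zero hγ_lt hγ_deriv hγ_plus hγ_minus hγ
  rw [halfStrip_congr hΓ, h.closure_halfStrip] at hf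
  obtain ⟨W, hW, hWf, hW0, hWt0⟩ := exists_particular h hf
  have hWΓ : SolvesCauchy a l Γ 0 0 f W :=
    ⟨hW.contDiffOn, fun q hq => by
      have hqS := halfStrip_subset_strip hq
      rw [h.closure_halfStrip, dt_dt_eq_of_eqOn h.uniqueDiffOn_strip hW (fun _ _ => rfl) hqS,
        dx_dx_eq_of_eqOn h.uniqueDiffOn_strip hW (fun _ _ => rfl) hqS, hWf q hqS],
      fun x _ => hW0 x, fun x hx => by
      rw [h.closure_halfStrip, dt_eq_of_eqOn h.uniqueDiffOn_strip
        (hW.differentiable two_ne_zero) (fun _ _ => rfl) (h.mem_strip_initial hx), hWt0 x]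
      rfl⟩
  have hcover := closure_halfStrip_eq_iUnion h hΓ
  have hformula : ∀ u, SolvesMixed a b l γ φ ψ μ₁ μ₂ f u →
      ∀ w, SolvesCauchy a l γ 0 0 f w → ∀ (C : ℝ) (i j : ℕ),
        ∀ q ∈ closure (cell a l γ i j),
          u q = w q + gFun a b l γ φ ψ μ₁ μ₂ w C i (q.2 - a * q.1)
            + pFun a b l γ φ ψ μ₁ μ₂ w C j (q.2 + a * q.1) := fun u hu w hw C i j q hq =>
    ((solvesMixed_congr hΓ).1 hu).eq_of_mem_closure_cell h hΓ hW hWf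
      ((solvesCauchy_congr hΓ).1 hw) C i j hq
  have hWγ := (solvesCauchy_congr hΓ).2 hWΓ
  refine ⟨⟨?_, fun hm => ?_⟩, hcover, ⟨W, hWγ⟩, hformula⟩
  -- Existence alone forces the matching conditions.
  · rintro ⟨u, hu, -⟩
    have hu' := (solvesMixed_congr hΓ).1 hu
    obtain ⟨g, p, hg, hp, hgp⟩ := h.exists_waves hW hWf hu'.toSolvesCauchy
    obtain ⟨M, hM, hMμ⟩ := exists_contDiff_two_extension (convex_Ici 0) (uniqueDiffOn_Ici 0)
      isClosed_Ici nonempty_Ici hμ₁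
    have hs := hu'.waveSystem h hW (fun x _ => hW0 x) (fun x _ => hWt0 x) hg hp hgp
    exact (matching_congr hΓ).2 (hs.matching h hM hMμ.symm hW hWf hW0 hWt0 hg hp)
  · obtain ⟨u, hu⟩ := ((matching_congr hΓ).1 hm).exists_solvesMixed h hφ hψ hμ₁ hμ₂ hW hWf hW0 hWt0
    have hu' := (solvesMixed_congr hΓ).2 hu
    -- Uniqueness: on each closed cell both solutions equal the same expression, taken with $w=W$
    -- and $C=0$.
    refine ⟨u, hu', fun u' hu'' q hq => ?_⟩
    rw [hcover] at hq
    obtain ⟨i, j, hq⟩ := by simpa only [mem_iUnion] using hq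
    rw [hformula u hu' W hWγ 0 i j q hq, hformula u' hu'' W hWγ 0 i j q hq]
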